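/- **Definitions.** For a real matrix $F$ with $m\ge1$ columns and at least $m$ rows let $s_{\max}(F)$ and $s_{\min}(F)$ be the largest and the smallest of its $m$ singular values, and let $\mathrm{Cond}(F)=s_{\max}(F)/s_{\min}(F)$ when $s_{\min}(F)>0$. For $T\subseteq\{1,\dots,n\}$ let $F_T$ be the submatrix of $F\in\mathbb{R}^{n\times m}$ formed by the rows with index in $T$. For $\beta\in(0,1)$ with $\beta n\in\mathbb{N}$ and $C>0$, a matrix $F\in\mathbb{R}^{n\times m}$ ($n>m$) is a *numerically erasure robust frame (NERF) of level $(\beta,C)$* if its rows span $\mathbb{R}^m$, any $m$ of its rows form a basis of $\mathbb{R}^m$, and for every $T\subseteq\{1,\dots,n\}$ with $|T^c|=\beta n$ one has $s_{\min}(F_T)>0$ and $\mathrm{Cond}(F_T)\le C$. Let $W_0$ denote the principal branch of the Lambert $W$ function, i.e. for $z\ge -e^{-1}$, $W_0(z)$ is the unique $w\ge-1$ with $we^w=z$. **Theorem.** Let $n>m\ge1$, let $A\in\mathbb{R}^{n\times m}$ be a random matrix with i.i.d. standard normal entries, and let $\lambda=1-\frac mn$. Let $\nu>0$ and $\beta\in(0,\lambda)$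 with $\beta n\in\mathbb{N}$. Put $$\lambda(\beta)=\frac{\lambda-\beta}{1-\beta}=1-\frac{m}{(1-\beta)n},\qquad \alpha=\alpha(\nu,\lambda,\beta)=\nu+(1-\lambda)^{-1}\ln\left[\beta^{-\beta}(1-\beta)^{-(1-\beta)}\right],$$ and, for $\epsilon\in(0,1)$, $$\mu(\epsilon)=\alpha+\ln(1+2\epsilon^{-1}),\qquad r(\epsilon)=(1-\lambda(\beta))^{-1/2}+1+\sqrt{2\mu(\epsilon)},$$ $$q(\epsilon)=-(1-\lambda(\beta))^{-1}\,W_0\!\left(-e^{-2\mu(\epsilon)(1-\lambda(\beta))-\frac65}\right).$$ Finally put $$P(\nu,\lambda,\beta)=\sup_{\epsilon\in(0,1)}\left(\sqrt{q(\epsilon)}-\epsilon\, r(\epsilon)\right),\qquad R(\nu,\lambda,\beta)=(1-\lambda(\beta))^{-1/2}+1+\sqrt{2\alpha}.$$ Then $\lambda(\beta)$, $\alpha$, $P(\nu,\lambda,\beta)$, $R(\nu,\lambda,\beta)$, and $\mu(\epsilon)$, $r(\epsilon)$, $q(\epsilon)$ for every $\epsilon\in(0,1)$, are all positive, and with probability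 at least $1-3e^{-\nu m}$ the matrix $A$ is a NERF of level $\left(\beta,\frac{R(\nu,\lambda,\beta)}{P(\nu,\lambda,\beta)}\right)$. -/

import Mathlib

noncomputable section

namespace GaussianNERF

/-- The principal branch `W₀` of the Lambert `W` function: the inverse of `w ↦ w * exp w`
restricted to `[-1, ∞)`. It is meaningful on `[-exp (-1), ∞)`. -/
def lambertW0 (z : ℝ) : ℝ :=
  Function.invFunOn (fun w : ℝ => w * Real.exp w) (Set.Ici (-1)) z

/-- On `[-exp (-1), ∞)` the value `W₀ z` is a solution `w ≥ -1` of `w * exp w = z`. -/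
theorem lambertW0_spec {z : ℝ} (hz : -Real.exp (-1) ≤ z) :
    -1 ≤ lambertW0 z ∧ lambertW0 z * Real.exp (lambertW0 z) = z := by
  have hc : ContinuousOn (fun w : ℝ => w * Real.exp w) (Set.Icc (-1) (max 0 z)) := by fun_prop
  have hle : (-1 : ℝ) ≤ max 0 z := le_trans (by norm_num) (le_max_left 0 z)
  have h0 : (0 : ℝ) ≤ max 0 z := le_max_left 0 z
  have hub : z ≤ max 0 z * Real.exp (max 0 z) :=
    (le_max_right 0 z).trans (le_mul_of_one_le_right h0 (Real.one_le_exp h0))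
  obtain ⟨w, hw, hwz⟩ := intermediate_value_Icc hle hc ⟨by simpa using hz, hub⟩
  have hex : ∃ a ∈ Set.Ici (-1 : ℝ), (fun w : ℝ => w * Real.exp w) a = z := ⟨w, hw.1, hwz⟩
  exact ⟨Function.invFunOn_mem hex, Function.invFunOn_eq hex⟩

/-- The solution `w ≥ -1` of `w * exp w = z` is unique. -/
theorem eq_lambertW0 {z w : ℝ} (hw : -1 ≤ w) (hwz : w * Real.exp w = z) : lambertW0 z = w := by
  have hmono : StrictMonoOn (fun w : ℝ => w * Real.exp w) (Set.Ici (-1)) := by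
    apply strictMonoOn_of_deriv_pos (convex_Ici _) (by fun_prop)
    intro x hx
    rw [interior_Ici, Set.mem_Ioi] at hx
    have hd : HasDerivAt (fun w : ℝ => w * Real.exp w) (1 * Real.exp x + x * Real.exp x) x :=
      (hasDerivAt_id x).mul (Real.hasDerivAt_exp x)
    rw [hd.deriv, ← add_mul]
    exact mul_pos (by linarith) (Real.exp_pos x)
  have hex : ∃ a ∈ Set.Ici (-1 : ℝ), (fun w : ℝ => w * Real.exp w) a = z := ⟨w, hw, hwz⟩
  exact hmono.injOn (Function.invFunOn_mem hex) hw ((Function.invFunOn_eq hex).trans hwz.symm)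

/-- The largest singular value of a matrix (as a map of Euclidean spaces). -/
def sMax {ι : Type*} [Fintype ι] {m : ℕ} (F : Matrix ι (Fin m) ℝ) : ℝ :=
  (Matrix.toEuclideanLin F).singularValues 0

/-- The smallest singular value of a matrix with `m` columns, `m ≥ 1`: the last of the `m`
numbers `s₀ ≥ s₁ ≥ … ≥ s_{m-1}` (square roots of the eigenvalues of `Fᵀ F`). -/
def sMin {ι : Type*} [Fintype ι] {m : ℕ} (F : Matrix ι (Fin m) ℝ) : ℝ :=
  (Matrix.toEuclideanLin F).singularValues (m - 1)

/-- The condition number `s_max / s_min` (only used together with `0 < s_min`). -/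
def condNumber {ι : Type*} [Fintype ι] {m : ℕ} (F : Matrix ι (Fin m) ℝ) : ℝ :=
  sMax F / sMin F

/-- The submatrix `F_T` consisting of the rows indexed by `T`. -/
def rowSubmatrix {n m : ℕ} (F : Matrix (Fin n) (Fin m) ℝ) (T : Finset (Fin n)) :
    Matrix T (Fin m) ℝ :=
  F.submatrix (fun i : T => (i : Fin n)) id

/-- `F` is a numerically erasure robust frame of level `(β, C)`. -/
structure IsNERF {n m : ℕ} (F : Matrix (Fin n) (Fin m) ℝ) (β C : ℝ) : Prop where
  /-- There are more rows than columns. -/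
  card_lt : m < n
  /-- The rows form a frame of `ℝ^m`. -/
  frame : Submodule.span ℝ (Set.range fun i : Fin n => F i) = ⊤
  /-- Any `m` rows form a basis of `ℝ^m`. -/
  basis : ∀ S : Finset (Fin n), S.card = m →
    LinearIndependent ℝ (fun i : S => F i) ∧
      Submodule.span ℝ (Set.range fun i : S => F i) = ⊤
  /-- The erasure ratio lies in `(0, 1)`. -/
  ratio_mem : β ∈ Set.Ioo (0 : ℝ) 1
  /-- The number `β n` of erased rows is a natural number. -/
  ratio_nat : ∃ k : ℕ, β * n = k
  /-- The bound is positive. -/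
  bound_pos : 0 < C
  /-- After erasing any `β n` rows the condition number is (well defined and) at most `C`. -/
  cond_le : ∀ T : Finset (Fin n), ((Tᶜ).card : ℝ) = β * n →
    0 < sMin (rowSubmatrix F T) ∧ condNumber (rowSubmatrix F T) ≤ C

/-- `λ(β) = (λ - β) / (1 - β)`, the redundancy rate after the erasure. -/
def lamErased (lam β : ℝ) : ℝ := (lam - β) / (1 - β)

/-- `α(ν, λ, β) = ν + (1 - λ)⁻¹ ln [β^(-β) (1 - β)^(-(1 - β))]`. -/
def alphaC (ν lam β : ℝ) : ℝ :=
  ν + (1 - lam)⁻¹ * Real.log (β ^ (-β) * (1 - β) ^ (-(1 - β)))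

/-- `μ_α(ε) = α + ln (1 + 2 ε⁻¹)`. -/
def muC (α ε : ℝ) : ℝ := α + Real.log (1 + 2 * ε⁻¹)

/-- `r(α, λ) = (1 - λ)^(-1/2) + 1 + √(2 α)`. -/
def rC (α lam : ℝ) : ℝ := (1 - lam) ^ (-(1 / 2) : ℝ) + 1 + √(2 * α)

/-- `q(α, λ) = -(1 - λ)⁻¹ W₀(-exp (-2 α (1 - λ) - 6/5))`. -/
def qC (α lam : ℝ) : ℝ :=
  -(1 - lam)⁻¹ * lambertW0 (-Real.exp (-2 * α * (1 - lam) - 6 / 5))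

/-- `P(ν, λ, β) = sup_{0 < ε < 1} (√q(μ_α(ε), λ(β)) - ε r(μ_α(ε), λ(β)))`,
with `α = α(ν, λ, β)`. -/
def PC (ν lam β : ℝ) : ℝ :=
  ⨆ ε : Set.Ioo (0 : ℝ) 1,
    (√(qC (muC (alphaC ν lam β) ε) (lamErased lam β))
      - ε * rC (muC (alphaC ν lam β) ε) (lamErased lam β))

/-- `R(ν, λ, β) = (1 - λ(β))^(-1/2) + 1 + √(2 α(ν, λ, β))`. -/
def RC (ν lam β : ℝ) : ℝ := rC (alphaC ν lam β) (lamErased lam β)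

end GaussianNERF

end

open GaussianNERF

/-! Erasing k = βn rows leaves a Gaussian matrix with N = n - k rows. A uniform bound √m P ≤ s_min ≤
s_max ≤ √m R over all such submatrices gives condition number at most R/P. The requirement that any
m rows form a basis holds almost surely, because the determinant vanishes only on a null set.

For one submatrix, the upper tail is P(s_max > √N + √m + θ) ≤ exp(-θ²/2). A Slepian-type comparison
(`integral_expSum_rpow_le`) replaces the bilinear form ⟨u, Bv⟩ + γ by the decoupled ⟨u, g⟩ + ⟨v, h⟩,
whose maximum is at most ‖g‖ + ‖h‖. The comparison is made for E (∑ exp(θX_i/p))^p, which tends to E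
exp(θ max X_i) as p → 0. So the number of net points drops out, and the nets may be refined without
cost (`measureReal_bilin_ge_le`, `measureReal_sMax_gt_le`).

For s_min, each point x of an ε-net of the sphere satisfies ‖Bx‖² > m q(ε) except with probability
exp(-μm), by Chernoff's bound for χ²; the Lambert function solves the resulting equation
(`measureReal_sum_sq_le`). Since μ = α + ln(1 + 2/ε), the net of at most (1 + 2/ε)^m points costs
exp(-αm) in total. Passing from the net to the sphere loses ε s_max, whence √q - ε r
(`measureReal_singularValues_le`).

The entropy term in α pays for the choice of erased rows: the binomial coefficient is at most exp((α
- ν)m), so the total failure probability is at most 2 exp(-νm). The supremum over ε is reached by a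
monotone limit of events, and it is positive because √q decays no faster than a constant times
ε^(1-λ(β)), while ε r is of order ε up to a logarithmic factor. -/

namespace GaussianNERF

open MeasureTheory ProbabilityTheory Filter
open scoped Topology

/-! ### Gaussian integration by parts on a finite product. -/

section GaussianProduct

variable {κ : Type*} [Fintype κ]

/-- The standard Gaussian measure on `κ → ℝ`, as a product of one-dimensional measures. -/
noncomputable abbrev gaussPi (κ : Type*) [Fintype κ] : Measure (κ → ℝ) :=
  Measure.pi fun _ : κ => gaussianReal 0 1

theorem integrable_exp_sum_abs (M : ℝ) :
    Integrable (fun x : κ → ℝ => Real.exp (M * ∑ k, |x k|)) (gaussPi κ) := by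
  have h1 : Integrable (fun s : ℝ => Real.exp (M * |s|)) (gaussianReal 0 1) :=
    integrable_exp_mul_abs (integrable_exp_mul_gaussianReal M) (integrable_exp_mul_gaussianReal (-M))
  have := Integrable.fintype_prod (μ := fun _ : κ => gaussianReal 0 1) (fun _ : κ => h1)
  simpa [Finset.mul_sum, Real.exp_sum] using this

theorem integrable_of_le_exp_sum_abs {f : (κ → ℝ) → ℝ} (hf : Continuous f) {C M : ℝ}
    (hfb : ∀ x, |f x| ≤ C * Real.exp (M * ∑ k, |x k|)) : Integrable f (gaussPi κ) :=
  ((integrable_exp_sum_abs M).const_mul C).mono' hf.aestronglyMeasurable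
    (Eventually.of_forall hfb)

/-- Stein's identity for the standard Gaussian on the line. -/
theorem integral_id_mul_gaussianReal {h h' : ℝ → ℝ} (hd : ∀ s, HasDerivAt h (h' s) s)
    (hi : Integrable h (gaussianReal 0 1)) (hi1 : Integrable (fun s => s * h s) (gaussianReal 0 1))
    (hi' : Integrable h' (gaussianReal 0 1)) :
    ∫ s, s * h s ∂gaussianReal 0 1 = ∫ s, h' s ∂gaussianReal 0 1 := by
  have key : ∀ f : ℝ → ℝ, Integrable f (gaussianReal 0 1) →
      Integrable (fun s => f s * gaussianPDFReal 0 1 s) := by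
    intro f hf
    rw [gaussianReal_of_var_ne_zero _ one_ne_zero,
      integrable_withDensity_iff_integrable_smul' (measurable_gaussianPDF 0 1)
        (Eventually.of_forall fun _ => gaussianPDF_lt_top)] at hf
    simpa [toReal_gaussianPDF, mul_comm] using hf
  have hpdf : ∀ s, HasDerivAt (gaussianPDFReal 0 1) (-(s * gaussianPDFReal 0 1 s)) s := by
    intro s
    have h1 : HasDerivAt (fun x : ℝ => (√(2 * Real.pi * (1 : NNReal)))⁻¹ *
        Real.exp (-(x - 0) ^ 2 / (2 * (1 : NNReal)))) ((√(2 * Real.pi * (1 : NNReal)))⁻¹ *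
        (Real.exp (-(s - 0) ^ 2 / (2 * (1 : NNReal))) *
          (-(2 * (s - 0)) / (2 * (1 : NNReal))))) s := by
      refine HasDerivAt.const_mul _ (HasDerivAt.exp (HasDerivAt.div_const ?_ _))
      have := (((hasDerivAt_id s).sub_const 0).pow 2).neg
      simpa using! this
    rw [gaussianPDFReal_def]
    convert h1 using 1
    simp
    ring
  have := integral_mul_deriv_eq_deriv_mul_of_integrable (u := h) (u' := h')
    (v := gaussianPDFReal 0 1) (v' := fun s => -(s * gaussianPDFReal 0 1 s))
    (fun s _ => hd s) (fun s _ => hpdf s)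
    (by
      have := (key _ hi1).neg
      refine this.congr (Eventually.of_forall fun s => ?_)
      simp; ring)
    (key _ hi') (key _ hi)
  rw [integral_gaussianReal_eq_integral_smul one_ne_zero,
    integral_gaussianReal_eq_integral_smul one_ne_zero]
  simp only [smul_eq_mul]
  have e1 : ∫ x, gaussianPDFReal 0 1 x * (x * h x) =
      - ∫ x, h x * -(x * gaussianPDFReal 0 1 x) := by
    rw [← integral_neg]; congr 1; ext x; ring
  rw [e1, this, neg_neg]
  congr 1; ext x; ring

/-- Resampling one coordinate independently does not change the product law. This gives Fubini in
coordinate k without splitting the index type. -/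
theorem measurePreserving_update [DecidableEq κ] (k : κ) :
    MeasurePreserving (fun q : (κ → ℝ) × ℝ => Function.update q.1 k q.2)
      ((gaussPi κ).prod (gaussianReal 0 1)) (gaussPi κ) := by
  have hm : Measurable (fun q : (κ → ℝ) × ℝ => Function.update q.1 k q.2) := by
    refine measurable_pi_lambda _ fun i => ?_
    by_cases h : i = k
    · subst h; simpa using measurable_snd
    · simpa [Function.update_of_ne h] using! (measurable_pi_apply i).comp measurable_fst
  refine ⟨hm, ?_⟩
  refine (Measure.pi_eq fun s hs => ?_).symm
  rw [Measure.map_apply hm (.univ_pi hs)]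
  have : (fun q : (κ → ℝ) × ℝ => Function.update q.1 k q.2) ⁻¹' Set.univ.pi s =
      (Set.univ.pi (Function.update s k Set.univ)) ×ˢ s k := by
    ext q
    simp only [Set.mem_preimage, Set.mem_pi, Set.mem_univ, true_imp_iff, Set.mem_prod]
    constructor
    · intro h
      refine ⟨fun i => ?_, by simpa using h k⟩
      by_cases hi : i = k
      · subst hi; simp
      · simpa [Function.update_of_ne hi] using h i
    · rintro ⟨h1, h2⟩ i
      by_cases hi : i = k
      · subst hi; simpa using h2
      · simpa [Function.update_of_ne hi] using h1 i
  rw [this, Measure.prod_prod, Measure.pi_pi,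
    ← Finset.mul_prod_erase Finset.univ _ (Finset.mem_univ k),
    ← Finset.mul_prod_erase Finset.univ (fun i => gaussianReal 0 1 (s i)) (Finset.mem_univ k)]
  simp only [Function.update_self, measure_univ, one_mul]
  rw [mul_comm]
  congr 1
  refine Finset.prod_congr rfl fun i hi => ?_
  rw [Function.update_of_ne (Finset.ne_of_mem_erase hi)]

/-- Gaussian integration by parts in one coordinate. -/
theorem integral_coord_mul_gaussPi [DecidableEq κ] (k : κ) {f f' : (κ → ℝ) → ℝ}
    (hd : ∀ x, HasDerivAt (fun s => f (Function.update x k s)) (f' x) (x k))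
    (hi : Integrable f (gaussPi κ)) (hi1 : Integrable (fun x => x k * f x) (gaussPi κ))
    (hi' : Integrable f' (gaussPi κ)) :
    ∫ x, x k * f x ∂gaussPi κ = ∫ x, f' x ∂gaussPi κ := by
  have mp := measurePreserving_update (κ := κ) k
  have tr : ∀ g : (κ → ℝ) → ℝ, Integrable g (gaussPi κ) →
      Integrable (fun q : (κ → ℝ) × ℝ => g (Function.update q.1 k q.2))
        ((gaussPi κ).prod (gaussianReal 0 1)) ∧
      ∫ x, g x ∂gaussPi κ = ∫ x, ∫ s, g (Function.update x k s) ∂gaussianReal 0 1 ∂gaussPi κ := by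
    intro g hg
    have h1 : Integrable (fun q : (κ → ℝ) × ℝ => g (Function.update q.1 k q.2))
        ((gaussPi κ).prod (gaussianReal 0 1)) := mp.integrable_comp_of_integrable hg
    refine ⟨h1, ?_⟩
    rw [← integral_prod _ h1]
    conv_lhs => rw [← mp.map_eq]
    rw [integral_map mp.measurable.aemeasurable]
    rw [mp.map_eq]; exact hg.aestronglyMeasurable
  rw [(tr _ hi1).2, (tr _ hi').2]
  refine integral_congr_ae ?_
  filter_upwards [(tr _ hi).1.prod_right_ae, (tr _ hi1).1.prod_right_ae, (tr _ hi').1.prod_right_ae]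
    with x h1 h2 h3
  simp only [Function.update_self] at h2 ⊢
  refine integral_id_mul_gaussianReal (fun s => ?_) h1 h2 h3
  simpa using hd (Function.update x k s)

end GaussianProduct

/-! ### Gaussian interpolation and the comparison inequality. -/

section Comparison

variable {κ I : Type*} [Fintype κ] [Fintype I]

/-- The sum of exponentials of the linear forms `x ↦ ∑ k, c i k * x k`. -/
noncomputable def expSum (c : I → κ → ℝ) (x : κ → ℝ) : ℝ := ∑ i, Real.exp (∑ k, c i k * x k)

theorem continuous_expSum (c : I → κ → ℝ) : Continuous (expSum c) := by
  unfold expSum; fun_prop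

theorem exp_le_expSum (c : I → κ → ℝ) (x : κ → ℝ) (i : I) :
    Real.exp (∑ k, c i k * x k) ≤ expSum c x :=
  Finset.single_le_sum (f := fun i => Real.exp (∑ k, c i k * x k))
    (fun _ _ => (Real.exp_pos _).le) (Finset.mem_univ i)

theorem expSum_pos [Nonempty I] (c : I → κ → ℝ) (x : κ → ℝ) : 0 < expSum c x :=
  Finset.sum_pos (fun _ _ => Real.exp_pos _) Finset.univ_nonempty

theorem expSum_le {c : I → κ → ℝ} {M : ℝ} (hM : ∀ i k, |c i k| ≤ M) (x : κ → ℝ) :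
    expSum c x ≤ Fintype.card I * Real.exp (M * ∑ k, |x k|) := by
  rw [← nsmul_eq_mul]
  refine Finset.sum_le_card_nsmul _ _ _ fun i _ => Real.exp_le_exp.2 ?_
  rw [Finset.mul_sum]
  refine Finset.sum_le_sum fun k _ => (le_abs_self _).trans ?_
  rw [abs_mul]
  exact mul_le_mul_of_nonneg_right (hM i k) (abs_nonneg _)

theorem expSum_rpow_le [Nonempty I] {c : I → κ → ℝ} {M p : ℝ} (hM0 : 0 ≤ M) (hp : 0 ≤ p)
    (hp1 : p ≤ 1) (hM : ∀ i k, |c i k| ≤ M) (x : κ → ℝ) :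
    expSum c x ^ p ≤ (1 + Fintype.card I) * Real.exp (M * ∑ k, |x k|) := by
  have h0 := expSum_pos c x
  have h1 : expSum c x ^ p ≤ 1 + expSum c x := by
    rcases le_total (expSum c x) 1 with h | h
    · exact (Real.rpow_le_one h0.le h hp).trans (by linarith)
    · exact (Real.rpow_le_rpow_of_exponent_le h hp1).trans (by rw [Real.rpow_one]; linarith)
  have h2 : 1 ≤ Real.exp (M * ∑ k, |x k|) :=
    Real.one_le_exp (mul_nonneg hM0 (Finset.sum_nonneg fun _ _ => abs_nonneg _))
  have := expSum_le hM x
  nlinarith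

/-- The derivative of `expSum c x ^ p` along a differentiable path of coefficients or points. -/
theorem hasDerivAt_expSum_rpow [Nonempty I] {L : I → ℝ → ℝ} {L' : I → ℝ} {t : ℝ} (p : ℝ)
    (hL : ∀ i, HasDerivAt (L i) (L' i) t) :
    HasDerivAt (fun t => (∑ i, Real.exp (L i t)) ^ p)
      (p * (∑ i, Real.exp (L i t)) ^ (p - 1) * ∑ i, L' i * Real.exp (L i t)) t := by
  have h1 : HasDerivAt (fun t => ∑ i, Real.exp (L i t)) (∑ i, Real.exp (L i t) * L' i) t :=
    HasDerivAt.fun_sum fun i _ => (hL i).exp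
  have h0 : 0 < ∑ i, Real.exp (L i t) :=
    Finset.sum_pos (fun _ _ => Real.exp_pos _) Finset.univ_nonempty
  have := h1.rpow_const (p := p) (Or.inl h0.ne')
  convert this using 1
  simp_rw [mul_comm (L' _)]
  ring

/-- The softmax weight `S ^ (p - 1) * exp (L i)`. -/
noncomputable def softWeight (p : ℝ) (c : I → κ → ℝ) (i : I) (x : κ → ℝ) : ℝ :=
  expSum c x ^ (p - 1) * Real.exp (∑ k, c i k * x k)

/-- The second order weight `S ^ (p - 2) * exp (L i) * exp (L j)`. -/
noncomputable def softWeight₂ (p : ℝ) (c : I → κ → ℝ) (i j : I) (x : κ → ℝ) : ℝ :=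
  expSum c x ^ (p - 2) * Real.exp (∑ k, c j k * x k) * Real.exp (∑ k, c i k * x k)

theorem continuous_expSum_rpow [Nonempty I] (q : ℝ) (c : I → κ → ℝ) :
    Continuous fun x => expSum c x ^ q :=
  (continuous_expSum c).rpow_const fun x => Or.inl (expSum_pos c x).ne'

theorem continuous_softWeight [Nonempty I] (p : ℝ) (c : I → κ → ℝ) (i : I) :
    Continuous (softWeight p c i) :=
  (continuous_expSum_rpow _ c).mul (by fun_prop)

theorem continuous_softWeight₂ [Nonempty I] (p : ℝ) (c : I → κ → ℝ) (i j : I) :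
    Continuous (softWeight₂ p c i j) :=
  ((continuous_expSum_rpow _ c).mul (by fun_prop)).mul (by fun_prop)

theorem softWeight_nonneg [Nonempty I] (p : ℝ) (c : I → κ → ℝ) (i : I) (x : κ → ℝ) :
    0 ≤ softWeight p c i x :=
  mul_nonneg (Real.rpow_nonneg (expSum_pos c x).le _) (Real.exp_pos _).le

theorem softWeight₂_nonneg [Nonempty I] (p : ℝ) (c : I → κ → ℝ) (i j : I) (x : κ → ℝ) :
    0 ≤ softWeight₂ p c i j x :=
  mul_nonneg (mul_nonneg (Real.rpow_nonneg (expSum_pos c x).le _) (Real.exp_pos _).le)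
    (Real.exp_pos _).le

theorem softWeight_le [Nonempty I] (p : ℝ) (c : I → κ → ℝ) (i : I) (x : κ → ℝ) :
    softWeight p c i x ≤ expSum c x ^ p := by
  have h0 := expSum_pos c x
  calc softWeight p c i x ≤ expSum c x ^ (p - 1) * expSum c x :=
        mul_le_mul_of_nonneg_left (exp_le_expSum c x i) (Real.rpow_nonneg h0.le _)
    _ = expSum c x ^ p := by
        rw [← Real.rpow_add_one h0.ne']; congr 1; ring

theorem softWeight₂_le [Nonempty I] (p : ℝ) (c : I → κ → ℝ) (i j : I) (x : κ → ℝ) :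
    softWeight₂ p c i j x ≤ expSum c x ^ p := by
  have h0 := expSum_pos c x
  refine le_trans ?_ (softWeight_le p c i x)
  refine mul_le_mul_of_nonneg_right ?_ (Real.exp_pos _).le
  calc expSum c x ^ (p - 2) * Real.exp (∑ k, c j k * x k)
      ≤ expSum c x ^ (p - 2) * expSum c x :=
        mul_le_mul_of_nonneg_left (exp_le_expSum c x j) (Real.rpow_nonneg h0.le _)
    _ = expSum c x ^ (p - 1) := by
        rw [← Real.rpow_add_one h0.ne']; congr 1; ring

theorem sum_softWeight₂ [Nonempty I] (p : ℝ) (c : I → κ → ℝ) (i : I) (x : κ → ℝ) :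
    ∑ j, softWeight₂ p c i j x = softWeight p c i x := by
  have h0 := expSum_pos c x
  have e : expSum c x ^ (p - 1) = expSum c x ^ (p - 2) * expSum c x := by
    rw [← Real.rpow_add_one h0.ne']; congr 1; ring
  simp only [softWeight₂, softWeight]
  rw [← Finset.sum_mul, ← Finset.mul_sum, e]
  rfl

theorem abs_coord_le_exp (x : κ → ℝ) (k : κ) : |x k| ≤ Real.exp (1 * ∑ k, |x k|) := by
  have h1 : |x k| ≤ ∑ k, |x k| :=
    Finset.single_le_sum (f := fun k => |x k|) (fun _ _ => abs_nonneg _) (Finset.mem_univ k)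
  have := Real.add_one_le_exp (1 * ∑ k, |x k|)
  linarith

theorem integrable_softWeight [Nonempty I] {p : ℝ} (hp : 0 ≤ p) (hp1 : p ≤ 1) (c : I → κ → ℝ)
    (i : I) : Integrable (softWeight p c i) (gaussPi κ) ∧
      (∀ j, Integrable (softWeight₂ p c i j) (gaussPi κ)) ∧
      (∀ k, Integrable (fun x => x k * softWeight p c i x) (gaussPi κ)) ∧
      Integrable (fun x => expSum c x ^ p) (gaussPi κ) := by
  have hM : ∀ i k, |c i k| ≤ ∑ i, ∑ k, |c i k| := fun i k =>
    (Finset.single_le_sum (f := fun k => |c i k|) (fun _ _ => abs_nonneg _)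
      (Finset.mem_univ k)).trans
    (Finset.single_le_sum (f := fun i => ∑ k, |c i k|)
      (fun _ _ => Finset.sum_nonneg fun _ _ => abs_nonneg _) (Finset.mem_univ i))
  have hM0 : 0 ≤ ∑ i, ∑ k, |c i k| :=
    Finset.sum_nonneg fun _ _ => Finset.sum_nonneg fun _ _ => abs_nonneg _
  have hb := expSum_rpow_le hM0 hp hp1 hM
  refine ⟨integrable_of_le_exp_sum_abs (C := 1 + Fintype.card I) (M := ∑ i, ∑ k, |c i k|)
      (continuous_softWeight p c i) fun x => ?_, fun j =>
    integrable_of_le_exp_sum_abs (C := 1 + Fintype.card I) (M := ∑ i, ∑ k, |c i k|)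
      (continuous_softWeight₂ p c i j) fun x => ?_, fun k =>
    integrable_of_le_exp_sum_abs (C := 1 + Fintype.card I) (M := 1 + ∑ i, ∑ k, |c i k|)
      ((continuous_apply k).mul (continuous_softWeight p c i)) fun x => ?_,
    integrable_of_le_exp_sum_abs (C := 1 + Fintype.card I) (M := ∑ i, ∑ k, |c i k|)
      (continuous_expSum_rpow p c) fun x => ?_⟩
  · rw [abs_of_nonneg (softWeight_nonneg p c i x)]
    exact (softWeight_le p c i x).trans (hb x)
  · rw [abs_of_nonneg (softWeight₂_nonneg p c i j x)]
    exact (softWeight₂_le p c i j x).trans (hb x)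
  · rw [abs_mul, abs_of_nonneg (softWeight_nonneg p c i x),
      add_mul 1 (∑ i, ∑ k, |c i k|), Real.exp_add, mul_left_comm]
    exact mul_le_mul (abs_coord_le_exp x k) ((softWeight_le p c i x).trans (hb x))
      (softWeight_nonneg p c i x) (Real.exp_pos _).le
  · rw [abs_of_nonneg (Real.rpow_nonneg (expSum_pos c x).le _)]
    exact hb x

/-- Integration by parts in x k. Differentiating the exponential gives c i k times the weight, which
`sum_softWeight₂` spreads over j; differentiating the power of the sum gives the terms with factor p
- 1. -/
theorem integral_coord_mul_softWeight [Nonempty I] {p : ℝ} (hp : 0 ≤ p) (hp1 : p ≤ 1)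
    (c : I → κ → ℝ) (i : I) (k : κ) :
    ∫ x, x k * softWeight p c i x ∂gaussPi κ =
      ∑ j, (c i k - (1 - p) * c j k) * ∫ x, softWeight₂ p c i j x ∂gaussPi κ := by
  classical
  obtain ⟨h1, h2, h3, -⟩ := integrable_softWeight hp hp1 c i
  have hint : Integrable (fun x => ∑ j, (c i k - (1 - p) * c j k) * softWeight₂ p c i j x)
      (gaussPi κ) := integrable_finsetSum _ fun j _ => (h2 j).const_mul _
  rw [integral_coord_mul_gaussPi k (f := softWeight p c i)
    (f' := fun x => ∑ j, (c i k - (1 - p) * c j k) * softWeight₂ p c i j x) ?_ h1 (h3 k) hint]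
  · rw [integral_finsetSum _ fun j _ => (h2 j).const_mul _]
    simp_rw [integral_const_mul]
  · intro x
    have hL : ∀ i, HasDerivAt (fun s => ∑ l, c i l * Function.update x k s l) (c i k) (x k) := by
      intro i
      have : HasDerivAt (fun s => ∑ l, c i l * Function.update x k s l)
          (∑ l, c i l * (Pi.single k (1 : ℝ) : κ → ℝ) l) (x k) :=
        HasDerivAt.fun_sum fun l _ => (hasDerivAt_pi.1 (hasDerivAt_update x k (x k)) l).const_mul _
      simpa [Pi.single_apply] using this
    have hd := (hasDerivAt_expSum_rpow (p - 1) hL).mul (hL i).exp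
    simp only [Function.update_eq_self] at hd
    convert! hd using 1
    have e : ∑ j, (c i k - (1 - p) * c j k) * softWeight₂ p c i j x =
        c i k * softWeight p c i x - (1 - p) * ∑ j, c j k * softWeight₂ p c i j x := by
      rw [← sum_softWeight₂, Finset.mul_sum, Finset.mul_sum, ← Finset.sum_sub_distrib]
      exact Finset.sum_congr rfl fun j _ => by ring
    rw [e]
    simp only [softWeight, softWeight₂, expSum]
    rw [show p - 1 - 1 = p - 2 by ring, Finset.mul_sum, Finset.mul_sum, Finset.sum_mul]
    rw [sub_eq_add_neg, add_comm, ← Finset.sum_neg_distrib]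
    congr 1
    · exact Finset.sum_congr rfl fun j _ => by ring
    · ring

/-- A Slepian-type comparison inequality: if the Gaussian families `X i = ⟨a i, x⟩` and
`Y i = ⟨b i, x⟩` are independent, have the same variances, and the covariances of `X` dominate,
then the expectation of a concave power of `∑ i, exp (X i)` is at most that of `∑ i, exp (Y i)`. -/
theorem integral_expSum_rpow_le [Nonempty I] {p : ℝ} (hp : 0 ≤ p) (hp1 : p ≤ 1)
    (a b : I → κ → ℝ) (horth : ∀ i j, ∑ k, a i k * b j k = 0)
    (hdiag : ∀ i, ∑ k, a i k * a i k = ∑ k, b i k * b i k)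
    (hcov : ∀ i j, ∑ k, b i k * b j k ≤ ∑ k, a i k * a j k) :
    ∫ x, expSum a x ^ p ∂gaussPi κ ≤ ∫ x, expSum b x ^ p ∂gaussPi κ := by
  -- Interpolation along a quarter circle: the coefficients are a at t = 0 and b at t = π/2, and c'
  -- is the derivative in t.
  set c : ℝ → I → κ → ℝ := fun t i k => Real.cos t * a i k + Real.sin t * b i k with hc
  set c' : ℝ → I → κ → ℝ := fun t i k => -Real.sin t * a i k + Real.cos t * b i k with hc'
  set M : ℝ := ∑ i, ∑ k, (|a i k| + |b i k|) with hMdef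
  have hM0 : 0 ≤ M := Finset.sum_nonneg fun _ _ => Finset.sum_nonneg fun _ _ => by positivity
  have hab : ∀ i k, |a i k| + |b i k| ≤ M := fun i k =>
    (Finset.single_le_sum (f := fun k => |a i k| + |b i k|) (fun _ _ => by positivity)
      (Finset.mem_univ k)).trans
    (Finset.single_le_sum (f := fun i => ∑ k, (|a i k| + |b i k|))
      (fun _ _ => Finset.sum_nonneg fun _ _ => by positivity) (Finset.mem_univ i))
  have hcM : ∀ t i k, |c t i k| ≤ M := fun t i k => by
    refine (abs_add_le _ _).trans (le_trans ?_ (hab i k))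
    rw [abs_mul, abs_mul]
    exact add_le_add (mul_le_of_le_one_left (abs_nonneg _) (Real.abs_cos_le_one t))
      (mul_le_of_le_one_left (abs_nonneg _) (Real.abs_sin_le_one t))
  have hcM' : ∀ t i k, |c' t i k| ≤ M := fun t i k => by
    refine (abs_add_le _ _).trans (le_trans ?_ (hab i k))
    rw [abs_mul, abs_mul, abs_neg]
    exact add_le_add (mul_le_of_le_one_left (abs_nonneg _) (Real.abs_sin_le_one t))
      (mul_le_of_le_one_left (abs_nonneg _) (Real.abs_cos_le_one t))
  have hL : ∀ (x : κ → ℝ) (t : ℝ) i,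
      HasDerivAt (fun t => ∑ k, c t i k * x k) (∑ k, c' t i k * x k) t := fun x t i =>
    HasDerivAt.fun_sum fun k _ => (((Real.hasDerivAt_cos t).mul_const _).add
      ((Real.hasDerivAt_sin t).mul_const _)).mul_const _
  have hint := fun t i => integrable_softWeight hp hp1 (c t) i
  have hderiv : ∀ t, HasDerivAt (fun t => ∫ x, expSum (c t) x ^ p ∂gaussPi κ)
      (∫ x, p * ∑ i, (∑ k, c' t i k * x k) * softWeight p (c t) i x ∂gaussPi κ) t := by
    intro t
    refine (hasDerivAt_integral_of_dominated_loc_of_deriv_le (s := Set.univ) (x₀ := t)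
      (F := fun t x => expSum (c t) x ^ p)
      (F' := fun t x => p * ∑ i, (∑ k, c' t i k * x k) * softWeight p (c t) i x)
      (bound := fun x => (p * (Fintype.card I * (M * (1 + Fintype.card I)))) *
        Real.exp ((1 + M) * ∑ k, |x k|))
      Filter.univ_mem (Eventually.of_forall fun s =>
        (continuous_expSum_rpow p (c s)).aestronglyMeasurable)
      (hint t (Classical.arbitrary I)).2.2.2 ?_ (Eventually.of_forall fun x s _ => ?_)
      ((integrable_exp_sum_abs (1 + M)).const_mul _)
      (Eventually.of_forall fun x s _ => ?_)).2
    · refine Continuous.aestronglyMeasurable (continuous_const.mul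
        (continuous_finsetSum _ fun i _ => Continuous.mul (by fun_prop)
          (continuous_softWeight p (c t) i)))
    · have hterm : ∀ i, |(∑ k, c' s i k * x k) * softWeight p (c s) i x| ≤
          M * (1 + Fintype.card I) * Real.exp ((1 + M) * ∑ k, |x k|) := by
        intro i
        have e1 : |∑ k, c' s i k * x k| ≤ M * Real.exp (1 * ∑ k, |x k|) := by
          calc |∑ k, c' s i k * x k| ≤ ∑ k, |c' s i k * x k| := Finset.abs_sum_le_sum_abs _ _
            _ ≤ ∑ k, M * |x k| := Finset.sum_le_sum fun k _ => by
                rw [abs_mul]; exact mul_le_mul_of_nonneg_right (hcM' s i k) (abs_nonneg _)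
            _ = M * ∑ k, |x k| := by rw [Finset.mul_sum]
            _ ≤ M * Real.exp (1 * ∑ k, |x k|) := mul_le_mul_of_nonneg_left
                (by have := Real.add_one_le_exp (1 * ∑ k, |x k|); linarith) hM0
        rw [abs_mul, abs_of_nonneg (softWeight_nonneg p (c s) i x), add_mul, Real.exp_add]
        calc _ ≤ (M * Real.exp (1 * ∑ k, |x k|)) *
              ((1 + Fintype.card I) * Real.exp (M * ∑ k, |x k|)) :=
              mul_le_mul e1 ((softWeight_le p (c s) i x).trans
                (expSum_rpow_le hM0 hp hp1 (hcM s) x)) (softWeight_nonneg p (c s) i x)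
                (mul_nonneg hM0 (Real.exp_pos _).le)
          _ = _ := by ring
      rw [Real.norm_eq_abs, abs_mul, abs_of_nonneg hp, mul_assoc]
      refine mul_le_mul_of_nonneg_left ((Finset.abs_sum_le_sum_abs _ _).trans
        ((Finset.sum_le_card_nsmul _ _ _ fun i _ => hterm i).trans ?_)) hp
      rw [nsmul_eq_mul, Finset.card_univ]
      exact le_of_eq (by ring)
    · have := hasDerivAt_expSum_rpow p (hL x s)
      convert! this using 1
      simp only [softWeight, expSum]
      rw [mul_assoc]
      congr 1
      rw [Finset.mul_sum]
      exact Finset.sum_congr rfl fun i _ => by ring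
  have hval : ∀ t, ∫ x, p * ∑ i, (∑ k, c' t i k * x k) * softWeight p (c t) i x ∂gaussPi κ =
      p * (1 - p) * (Real.sin t * Real.cos t) * ∑ i, ∑ j,
        (∑ k, a i k * a j k - ∑ k, b i k * b j k) * ∫ x, softWeight₂ p (c t) i j x ∂gaussPi κ := by
    intro t
    -- Covariance of the velocity at i with the process at j. Orthogonality removes the mixed terms,
    -- and equal variances make it vanish for i = j, so only the part with factor -(1 - p) survives
    -- and its sign is that of the covariance gap.
    have hcc : ∀ i j, ∑ k, c' t i k * c t j k =
        -(Real.sin t * Real.cos t) * (∑ k, a i k * a j k - ∑ k, b i k * b j k) := by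
      intro i j
      have h1 := horth i j
      have h2 := horth j i
      calc ∑ k, c' t i k * c t j k = ∑ k, (-(Real.sin t * Real.cos t) * (a i k * a j k)
            + (Real.sin t * Real.cos t) * (b i k * b j k)
            + (-Real.sin t * Real.sin t) * (a i k * b j k)
            + (Real.cos t * Real.cos t) * (a j k * b i k)) :=
            Finset.sum_congr rfl fun k _ => by simp only [hc, hc']; ring
        _ = _ := by
            simp only [Finset.sum_add_distrib, ← Finset.mul_sum, h1, h2]; ring
    rw [integral_const_mul, integral_finsetSum]
    swap
    · intro i _
      simp_rw [Finset.sum_mul, mul_assoc]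
      exact integrable_finsetSum _ fun k _ => ((hint t i).2.2.1 k).const_mul _
    rw [mul_assoc, mul_assoc]
    congr 1
    rw [← mul_assoc, Finset.mul_sum]
    refine Finset.sum_congr rfl fun i _ => ?_
    simp_rw [Finset.sum_mul, mul_assoc]
    rw [integral_finsetSum _ fun k _ => ((hint t i).2.2.1 k).const_mul _]
    simp_rw [integral_const_mul, integral_coord_mul_softWeight hp hp1, Finset.mul_sum]
    rw [Finset.sum_comm]
    refine Finset.sum_congr rfl fun j _ => ?_
    have hii := hcc i i
    rw [hdiag i, sub_self, mul_zero] at hii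
    calc ∑ k, c' t i k * ((c t i k - (1 - p) * c t j k) * ∫ x, softWeight₂ p (c t) i j x ∂gaussPi κ)
        = (∑ k, c' t i k * c t i k - (1 - p) * ∑ k, c' t i k * c t j k) *
            ∫ x, softWeight₂ p (c t) i j x ∂gaussPi κ := by
          rw [Finset.mul_sum, ← Finset.sum_sub_distrib, Finset.sum_mul]
          exact Finset.sum_congr rfl fun k _ => by ring
      _ = _ := by rw [hii, hcc i j]; ring
  have hmono : MonotoneOn (fun t => ∫ x, expSum (c t) x ^ p ∂gaussPi κ)
      (Set.Icc 0 (Real.pi / 2)) := by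
    refine monotoneOn_of_deriv_nonneg (convex_Icc _ _)
      (fun t _ => (hderiv t).continuousAt.continuousWithinAt)
      (fun t _ => (hderiv t).differentiableAt.differentiableWithinAt) fun t ht => ?_
    rw [interior_Icc] at ht
    rw [(hderiv t).deriv, hval]
    have hs := Real.sin_nonneg_of_nonneg_of_le_pi ht.1.le (by linarith [ht.2, Real.pi_pos])
    have hco := Real.cos_nonneg_of_neg_pi_div_two_le_of_le (by linarith [ht.1, Real.pi_pos]) ht.2.le
    refine mul_nonneg (mul_nonneg (mul_nonneg hp (by linarith)) (mul_nonneg hs hco))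
      (Finset.sum_nonneg fun i _ => Finset.sum_nonneg fun j _ =>
        mul_nonneg (sub_nonneg.2 (hcov i j)) (integral_nonneg fun x => softWeight₂_nonneg _ _ _ _ _))
  have := hmono (Set.left_mem_Icc.2 (by positivity)) (Set.right_mem_Icc.2 (by positivity))
    (by positivity : (0 : ℝ) ≤ Real.pi / 2)
  simpa [hc] using this

end Comparison

/-! ### Exponential moments of χ² and χ variables. -/

section ChiSquare

theorem integral_exp_mul_sq_gaussianReal {a : ℝ} (ha : a < 1 / 2) :
    ∫ s, Real.exp (a * s ^ 2) ∂gaussianReal 0 1 = (√(1 - 2 * a))⁻¹ := by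
  rw [integral_gaussianReal_eq_integral_smul one_ne_zero]
  have h : ∀ s : ℝ, gaussianPDFReal 0 1 s • Real.exp (a * s ^ 2) =
      (√(2 * Real.pi))⁻¹ * Real.exp (-(1 / 2 - a) * s ^ 2) := by
    intro s
    simp only [gaussianPDFReal, smul_eq_mul, NNReal.coe_one, mul_one, sub_zero]
    rw [mul_assoc, ← Real.exp_add]
    congr 2; ring
  simp_rw [h]
  rw [integral_const_mul, integral_gaussian, ← Real.sqrt_inv, ← Real.sqrt_inv,
    ← Real.sqrt_mul (by positivity)]
  congr 1
  have : (1 - 2 * a) ≠ 0 := by linarith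
  have : (1 / 2 - a) ≠ 0 := by linarith
  field_simp

theorem integrable_exp_mul_sq_gaussianReal {a : ℝ} (ha : a < 1 / 2) :
    Integrable (fun s => Real.exp (a * s ^ 2)) (gaussianReal 0 1) := by
  refine Integrable.of_integral_ne_zero ?_
  rw [integral_exp_mul_sq_gaussianReal ha]
  have : 0 < 1 - 2 * a := by linarith
  positivity

/-- A choice of parameter which turns the moment generating function of `χ²` into the bound
`exp (θ √N + θ² / 2)` for the moment generating function of `χ`. -/
theorem exists_chi_parameter (N : ℕ) (hN : 0 < N) {θ : ℝ} (hθ : 0 ≤ θ) :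
    ∃ c : ℝ, 0 < c ∧ θ < c ∧
      Real.exp (θ * c / 2) * (√(1 - θ / c))⁻¹ ^ N ≤ Real.exp (θ * √N + θ ^ 2 / 2) := by
  have hN' : (0 : ℝ) < N := by exact_mod_cast hN
  set w : ℝ := √N with hw
  have hw0 : 0 < w := Real.sqrt_pos.2 hN'
  have hw2 : w ^ 2 = N := Real.sq_sqrt hN'.le
  -- The witness c = √N y is the positive root of c² = θc + N, where the left-hand side is minimal
  -- in c. Then θ = √N (y - 1/y) and 1 - θ/c = y⁻², and the claim reduces to log y ≤ sinh(log y)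
  -- with y ≥ 1.
  set d : ℝ := √(θ ^ 2 + 4 * N) with hd
  have hd2 : d ^ 2 = θ ^ 2 + 4 * N := Real.sq_sqrt (by positivity)
  have hdw : 2 * w ≤ d := Real.le_sqrt_of_sq_le (by nlinarith)
  have hdθ : θ < d := Real.lt_sqrt_of_sq_lt (by linarith)
  set y : ℝ := (θ + d) / (2 * w) with hy
  have hy1 : 1 ≤ y := by rw [hy, le_div_iff₀ (by positivity)]; linarith
  have hy0 : 0 < y := by linarith
  have hθy : θ = w * (y - y⁻¹) := by
    have hyw : y * (2 * w) = θ + d := div_mul_cancel₀ _ (by positivity)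
    have : y * θ = w * (y * y - 1) := by
      have : (2 * w) * (2 * w) * (y * y) = (θ + d) ^ 2 := by rw [← hyw]; ring
      have h3 : 4 * w * (y * θ) = 2 * (θ + d) * θ := by rw [← hyw]; ring
      have : 4 * w * (y * θ) = 4 * w * (w * (y * y - 1)) := by
        rw [h3]; nlinarith
      exact mul_left_cancel₀ (by positivity) this
    have h2 : y * (w * (y - y⁻¹)) = w * (y * y - 1) := by field_simp
    exact mul_left_cancel₀ hy0.ne' (this.trans h2.symm)
  have hlog : Real.log y ≤ (y - y⁻¹) / 2 := by
    rw [← Real.sinh_log hy0]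
    exact Real.self_le_sinh_iff.2 (Real.log_nonneg hy1)
  have hyi : y⁻¹ ≤ 1 := inv_le_one_of_one_le₀ hy1
  refine ⟨w * y, by positivity, by rw [hθy]; nlinarith [mul_pos hw0 (inv_pos.2 hy0)], ?_⟩
  have e1 : 1 - θ / (w * y) = (y⁻¹) ^ 2 := by rw [hθy]; field_simp; ring
  rw [e1, Real.sqrt_sq (by positivity), inv_inv]
  have e2 : y ^ N = Real.exp (N * Real.log y) := by
    rw [mul_comm, Real.exp_mul, Real.exp_log hy0, Real.rpow_natCast]
  rw [e2, ← Real.exp_add]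
  refine Real.exp_le_exp.2 ?_
  rw [hθy, ← hw2]
  have h1 : y * y⁻¹ = 1 := mul_inv_cancel₀ hy0.ne'
  have h2 : Real.log y ≤ (y - y⁻¹) * (1 - y⁻¹ / 2) := by
    refine hlog.trans ?_
    have : 0 ≤ y - y⁻¹ := by linarith
    nlinarith
  have h3 := mul_le_mul_of_nonneg_left h2 (sq_nonneg w)
  nlinarith

end ChiSquare

/-! ### Decoupling of a Gaussian bilinear form. -/

section Chevet

variable {ι J I : Type*} [Fintype ι] [Fintype J] [Fintype I]

/-- AM-GM form of ⟨u, g⟩ ≤ ‖g‖: the bound is quadratic in g, so its exponential moments factor over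
the coordinates. -/
theorem sum_mul_le_half {ι : Type*} [Fintype ι] {c : ℝ} (hc : 0 < c) (u g : ι → ℝ)
    (hu : ∑ i, u i ^ 2 = 1) : ∑ i, u i * g i ≤ (c + (∑ i, g i ^ 2) / c) / 2 := by
  have : ∀ i, u i * g i ≤ (c * u i ^ 2 + g i ^ 2 / c) / 2 := by
    intro i
    have h : 0 ≤ (c * u i - g i) ^ 2 / c := by positivity
    have e : (c * u i - g i) ^ 2 / c = c * u i ^ 2 - 2 * (u i * g i) + g i ^ 2 / c := by
      field_simp
      ring
    linarith
  refine (Finset.sum_le_sum fun i _ => this i).trans (le_of_eq ?_)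
  rw [← Finset.sum_div, Finset.sum_add_distrib, ← Finset.mul_sum, hu, Finset.sum_div, mul_one]

theorem sum_mul_le_one {ι : Type*} [Fintype ι] (u w : ι → ℝ)
    (hu : ∑ i, u i ^ 2 = 1) (hw : ∑ i, w i ^ 2 = 1) : ∑ i, u i * w i ≤ 1 := by
  have := sum_mul_le_half one_pos u w hu
  rw [hw] at this; linarith

/-- The coefficients of the bilinear process `⟨u, B v⟩ + γ`. -/
noncomputable def bilinCoeff (β : ℝ) (u : I → ι → ℝ) (v : I → J → ℝ) (i : I) :
    (ι × J) ⊕ (Unit ⊕ (ι ⊕ J)) → ℝ :=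
  Sum.elim (fun q => β * (u i q.1 * v i q.2)) (Sum.elim (fun _ => β) 0)

/-- The coefficients of the decoupled process `⟨u, g⟩ + ⟨v, h⟩`. -/
noncomputable def splitCoeff (β : ℝ) (u : I → ι → ℝ) (v : I → J → ℝ) (i : I) :
    (ι × J) ⊕ (Unit ⊕ (ι ⊕ J)) → ℝ :=
  Sum.elim 0 (Sum.elim 0 (Sum.elim (fun k => β * u i k) (fun k => β * v i k)))

/-- Up to the factor β², the covariances are ⟨u,u'⟩⟨v,v'⟩ + 1 and ⟨u,u'⟩ + ⟨v,v'⟩. Their difference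
(1 - ⟨u,u'⟩)(1 - ⟨v,v'⟩) is nonnegative for unit vectors and zero on the diagonal; the extra
variable γ supplies the 1. -/
theorem integral_bilin_le_split [Nonempty I] {p : ℝ} (hp : 0 ≤ p) (hp1 : p ≤ 1) (β : ℝ)
    (u : I → ι → ℝ) (v : I → J → ℝ) (hu : ∀ i, ∑ k, u i k ^ 2 = 1)
    (hv : ∀ i, ∑ k, v i k ^ 2 = 1) :
    ∫ x, expSum (bilinCoeff β u v) x ^ p ∂gaussPi _ ≤
      ∫ x, expSum (splitCoeff β u v) x ^ p ∂gaussPi _ := by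
  have ha : ∀ i j, ∑ k, bilinCoeff β u v i k * bilinCoeff β u v j k =
      β ^ 2 * ((∑ k, u i k * u j k) * (∑ k, v i k * v j k) + 1) := by
    intro i j
    simp only [bilinCoeff, Fintype.sum_sum_type, Sum.elim_inl, Sum.elim_inr, Pi.zero_apply,
      mul_zero, Finset.sum_const_zero, add_zero, Fintype.sum_prod_type, Finset.univ_unique,
      Finset.sum_singleton, Finset.sum_mul_sum]
    rw [mul_add, mul_one, sq, Finset.mul_sum]
    congr 1
    refine Finset.sum_congr rfl fun k _ => ?_
    rw [Finset.mul_sum]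
    exact Finset.sum_congr rfl fun l _ => by ring
  have hb : ∀ i j, ∑ k, splitCoeff β u v i k * splitCoeff β u v j k =
      β ^ 2 * ((∑ k, u i k * u j k) + (∑ k, v i k * v j k)) := by
    intro i j
    simp only [splitCoeff, Fintype.sum_sum_type, Sum.elim_inl, Sum.elim_inr, Pi.zero_apply,
      mul_zero, Finset.sum_const_zero, zero_add]
    rw [mul_add, Finset.mul_sum, Finset.mul_sum]
    congr 1 <;> exact Finset.sum_congr rfl fun l _ => by ring
  refine integral_expSum_rpow_le hp hp1 _ _ (fun i j => ?_) (fun i => ?_) (fun i j => ?_)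
  · simp [bilinCoeff, splitCoeff, Fintype.sum_sum_type]
  · rw [ha, hb]
    simp_rw [← sq, hu, hv]; ring
  · rw [ha, hb]
    have h1 := sum_mul_le_one _ _ (hu i) (hu j)
    have h2 := sum_mul_le_one _ _ (hv i) (hv j)
    refine mul_le_mul_of_nonneg_left ?_ (sq_nonneg β)
    nlinarith

/-- Each summand is at most exp((θ/p)K) with K a quadratic bound for ‖g‖ + ‖h‖ independent of the
index. The p-th power turns this into card^p exp(θK), and the χ estimate is applied to g and h
separately. -/
theorem integral_split_le [Nonempty I] [Nonempty ι] [Nonempty J] {p θ : ℝ} (hp : 0 < p)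
    (hp1 : p ≤ 1) (hθ : 0 ≤ θ)
    (u : I → ι → ℝ) (v : I → J → ℝ) (hu : ∀ i, ∑ k, u i k ^ 2 = 1)
    (hv : ∀ i, ∑ k, v i k ^ 2 = 1) :
    ∫ x, expSum (splitCoeff (θ / p) u v) x ^ p ∂gaussPi _ ≤
      (Fintype.card I : ℝ) ^ p * Real.exp (θ * (√(Fintype.card ι) + √(Fintype.card J)) + θ ^ 2) := by
  obtain ⟨c, hc0, hc, hcb⟩ := exists_chi_parameter (Fintype.card ι) Fintype.card_pos hθ
  obtain ⟨d, hd0, hd, hdb⟩ := exists_chi_parameter (Fintype.card J) Fintype.card_pos hθ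
  have hac : θ / c / 2 < 1 / 2 := by
    have := (div_lt_one hc0).2 hc
    linarith
  have had : θ / d / 2 < 1 / 2 := by
    have := (div_lt_one hd0).2 hd
    linarith
  let f : (ι × J) ⊕ (Unit ⊕ (ι ⊕ J)) → ℝ → ℝ :=
    Sum.elim (fun _ _ => 1) (Sum.elim (fun _ _ => 1)
      (Sum.elim (fun _ s => Real.exp (θ / c / 2 * s ^ 2)) (fun _ s => Real.exp (θ / d / 2 * s ^ 2))))
  have hfi : Integrable (fun x : (ι × J) ⊕ (Unit ⊕ (ι ⊕ J)) → ℝ => ∏ k, f k (x k)) (gaussPi _) := by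
    refine Integrable.fintype_prod fun k => ?_
    rcases k with k | k | k | k
    · exact integrable_const _
    · exact integrable_const _
    · exact integrable_exp_mul_sq_gaussianReal hac
    · exact integrable_exp_mul_sq_gaussianReal had
  have hfv : ∫ x, ∏ k, f k (x k) ∂gaussPi ((ι × J) ⊕ (Unit ⊕ (ι ⊕ J))) =
      (√(1 - θ / c))⁻¹ ^ Fintype.card ι * (√(1 - θ / d))⁻¹ ^ Fintype.card J := by
    rw [integral_fintype_prod_eq_prod]
    simp only [Fintype.prod_sum_type, f, Sum.elim_inl, Sum.elim_inr,
      integral_exp_mul_sq_gaussianReal hac, integral_exp_mul_sq_gaussianReal had]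
    simp [mul_div_cancel₀]
  have hpt : ∀ x, expSum (splitCoeff (θ / p) u v) x ^ p ≤
      ((Fintype.card I : ℝ) ^ p * Real.exp (θ * c / 2 + θ * d / 2)) * ∏ k, f k (x k) := by
    intro x
    set K : ℝ := (c + (∑ i, x (.inr (.inr (.inl i))) ^ 2) / c) / 2 +
      (d + (∑ i, x (.inr (.inr (.inr i))) ^ 2) / d) / 2 with hK
    have h1 : expSum (splitCoeff (θ / p) u v) x ≤ Fintype.card I * Real.exp (θ / p * K) := by
      rw [← nsmul_eq_mul]
      refine Finset.sum_le_card_nsmul _ _ _ fun i _ => Real.exp_le_exp.2 ?_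
      have e : ∑ k, splitCoeff (θ / p) u v i k * x k = θ / p *
          (∑ k, u i k * x (.inr (.inr (.inl k))) + ∑ k, v i k * x (.inr (.inr (.inr k)))) := by
        simp only [splitCoeff, Fintype.sum_sum_type, Sum.elim_inl, Sum.elim_inr, Pi.zero_apply,
          zero_mul, Finset.sum_const_zero, zero_add]
        rw [mul_add, Finset.mul_sum, Finset.mul_sum]
        congr 1 <;> exact Finset.sum_congr rfl fun l _ => by ring
      rw [e]
      exact mul_le_mul_of_nonneg_left (add_le_add (sum_mul_le_half hc0 _ _ (hu i))
        (sum_mul_le_half hd0 _ _ (hv i))) (by positivity)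
    have h2 : ∏ k, f k (x k) = Real.exp (θ / c / 2 * ∑ i, x (.inr (.inr (.inl i))) ^ 2 +
        θ / d / 2 * ∑ i, x (.inr (.inr (.inr i))) ^ 2) := by
      simp only [Fintype.prod_sum_type, f, Sum.elim_inl, Sum.elim_inr, Finset.prod_const_one,
        one_mul, Real.exp_add, Finset.mul_sum, Real.exp_sum]
    rw [h2, mul_assoc, ← Real.exp_add]
    refine (Real.rpow_le_rpow (expSum_pos _ x).le h1 hp.le).trans (le_of_eq ?_)
    rw [Real.mul_rpow (by positivity) (Real.exp_pos _).le, ← Real.exp_mul]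
    congr 2
    rw [hK]
    field_simp
    ring
  calc ∫ x, expSum (splitCoeff (θ / p) u v) x ^ p ∂gaussPi _
      ≤ ∫ x, ((Fintype.card I : ℝ) ^ p * Real.exp (θ * c / 2 + θ * d / 2)) * ∏ k, f k (x k)
        ∂gaussPi _ := integral_mono
          (integrable_softWeight hp.le hp1 _ (Classical.arbitrary I)).2.2.2 (hfi.const_mul _) hpt
    _ = (Fintype.card I : ℝ) ^ p * ((Real.exp (θ * c / 2) * (√(1 - θ / c))⁻¹ ^ Fintype.card ι) *
        (Real.exp (θ * d / 2) * (√(1 - θ / d))⁻¹ ^ Fintype.card J)) := by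
      rw [integral_const_mul, hfv, Real.exp_add]; ring
    _ ≤ (Fintype.card I : ℝ) ^ p * (Real.exp (θ * √(Fintype.card ι) + θ ^ 2 / 2) *
        Real.exp (θ * √(Fintype.card J) + θ ^ 2 / 2)) := by
      refine mul_le_mul_of_nonneg_left (mul_le_mul hcb hdb (by positivity) (by positivity))
        (by positivity)
    _ = _ := by rw [← Real.exp_add]; congr 2; ring

/-- Markov's inequality: on the event, one summand alone makes the p-th power at least exp(θr). The
independent γ factors out and contributes exactly exp(θ²/2). -/
theorem integral_bilin_ge [Nonempty I] {p θ r : ℝ} (hp : 0 < p)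
    (hp1 : p ≤ 1) (hθ : 0 ≤ θ) (u : I → ι → ℝ) (v : I → J → ℝ) :
    (gaussPi (ι × J)).real {B | ∃ i, r ≤ ∑ q, u i q.1 * v i q.2 * B q} *
      (Real.exp (θ * r) * Real.exp (θ ^ 2 / 2)) ≤
    ∫ x, expSum (bilinCoeff (θ / p) u v) x ^ p ∂gaussPi _ := by
  let a : I → ι × J → ℝ := fun i q => θ / p * (u i q.1 * v i q.2)
  let H : (ι × J → ℝ) → ℝ := fun B => expSum a B ^ p
  have hHi : Integrable H (gaussPi (ι × J)) :=
    (integrable_softWeight hp.le hp1 a (Classical.arbitrary I)).2.2.2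
  have hH0 : ∀ B, 0 ≤ H B := fun B => Real.rpow_nonneg (expSum_pos a B).le _
  have hfac : ∀ x, expSum (bilinCoeff (θ / p) u v) x ^ p =
      H (fun q => x (.inl q)) * Real.exp (θ * x (.inr (.inl ()))) := by
    intro x
    have : expSum (bilinCoeff (θ / p) u v) x =
        expSum a (fun q => x (.inl q)) * Real.exp (θ / p * x (.inr (.inl ()))) := by
      simp only [expSum, Finset.sum_mul, ← Real.exp_add, bilinCoeff, Fintype.sum_sum_type,
        Sum.elim_inl, Sum.elim_inr, Pi.zero_apply, zero_mul, Finset.sum_const_zero, add_zero,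
        Finset.univ_unique, Finset.sum_singleton, a]
    rw [this, Real.mul_rpow (expSum_pos a _).le (Real.exp_pos _).le, ← Real.exp_mul]
    congr 2
    field_simp
  have hmgf : ∫ y, Real.exp (θ * y (.inl ())) ∂gaussPi (Unit ⊕ (ι ⊕ J)) = Real.exp (θ ^ 2 / 2) := by
    rw [integral_comp_eval (X := fun _ : Unit ⊕ (ι ⊕ J) => ℝ) (i := .inl ())
      (f := fun s : ℝ => Real.exp (θ * s))
      (by fun_prop : Continuous fun s : ℝ => Real.exp (θ * s)).aestronglyMeasurable]
    have := congrFun (mgf_id_gaussianReal (μ := 0) (v := 1)) θ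
    simpa [mgf] using this
  have hval : ∫ x, expSum (bilinCoeff (θ / p) u v) x ^ p ∂gaussPi _ =
      (∫ B, H B ∂gaussPi (ι × J)) * Real.exp (θ ^ 2 / 2) := by
    rw [← hmgf, ← integral_prod_mul (μ := gaussPi (ι × J)) (ν := gaussPi (Unit ⊕ (ι ⊕ J))) H
      (fun y => Real.exp (θ * y (.inl ())))]
    have mp := measurePreserving_sumPiEquivProdPi
      (fun _ : (ι × J) ⊕ (Unit ⊕ (ι ⊕ J)) => gaussianReal 0 1)
    rw [← mp.integral_comp']
    refine integral_congr_ae (Eventually.of_forall fun x => ?_)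
    simp only [hfac]
    rfl
  have hmk := mul_meas_ge_le_integral_of_nonneg (μ := gaussPi (ι × J))
    (Eventually.of_forall hH0) hHi (Real.exp (θ * r))
  have hsub : {B : ι × J → ℝ | ∃ i, r ≤ ∑ q, u i q.1 * v i q.2 * B q} ⊆
      {B | Real.exp (θ * r) ≤ H B} := by
    rintro B ⟨i, hi⟩
    have h1 : Real.exp (θ / p * r) ≤ expSum a B := by
      refine le_trans (Real.exp_le_exp.2 ?_) (exp_le_expSum a B i)
      calc θ / p * r ≤ θ / p * ∑ q, u i q.1 * v i q.2 * B q :=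
            mul_le_mul_of_nonneg_left hi (by positivity)
        _ = _ := by
            rw [Finset.mul_sum]
            exact Finset.sum_congr rfl fun q _ => by simp only [a]; ring
    have h2 := Real.rpow_le_rpow (Real.exp_pos _).le h1 hp.le
    rw [← Real.exp_mul] at h2
    have e : θ / p * r * p = θ * r := by field_simp
    rw [e] at h2
    exact h2
  rw [hval, ← mul_assoc]
  refine mul_le_mul_of_nonneg_right ?_ (Real.exp_pos _).le
  refine le_trans ?_ hmk
  rw [mul_comm]
  exact mul_le_mul_of_nonneg_left (measureReal_mono hsub) (Real.exp_pos _).le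

/-- Chevet-type tail bound for the maximum of a Gaussian bilinear form over finitely many pairs of
unit vectors. -/
theorem measureReal_bilin_ge_le [Nonempty I] [Nonempty ι] [Nonempty J] {θ r : ℝ} (hθ : 0 ≤ θ)
    (u : I → ι → ℝ) (v : I → J → ℝ) (hu : ∀ i, ∑ k, u i k ^ 2 = 1)
    (hv : ∀ i, ∑ k, v i k ^ 2 = 1) :
    (gaussPi (ι × J)).real {B | ∃ i, r ≤ ∑ q, u i q.1 * v i q.2 * B q} ≤
      Real.exp (θ * (√(Fintype.card ι) + √(Fintype.card J) - r) + θ ^ 2 / 2) := by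
  set X := (gaussPi (ι × J)).real {B | ∃ i, r ≤ ∑ q, u i q.1 * v i q.2 * B q} with hX
  set Y := Real.exp (θ * (√(Fintype.card ι) + √(Fintype.card J)) + θ ^ 2) with hY
  have h1 : ∀ p ∈ Set.Ioc (0 : ℝ) 1, X * (Real.exp (θ * r) * Real.exp (θ ^ 2 / 2)) ≤
      (Fintype.card I : ℝ) ^ p * Y := fun p hp =>
    (integral_bilin_ge hp.1 hp.2 hθ u v).trans
      ((integral_bilin_le_split hp.1.le hp.2 _ u v hu hv).trans
        (integral_split_le hp.1 hp.2 hθ u v hu hv))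
  -- As p → 0 the cardinality factor tends to 1, so the bound does not depend on the number of
  -- pairs.
  have hlim : Tendsto (fun p : ℝ => (Fintype.card I : ℝ) ^ p * Y) (𝓝[>] 0) (𝓝 (1 * Y)) := by
    refine Tendsto.mul_const _ ?_
    have : ContinuousAt (fun p : ℝ => (Fintype.card I : ℝ) ^ p) 0 :=
      Real.continuousAt_const_rpow (by exact_mod_cast Fintype.card_ne_zero)
    have h := this.tendsto
    rw [Real.rpow_zero] at h
    exact h.mono_left nhdsWithin_le_nhds
  have h2 : X * (Real.exp (θ * r) * Real.exp (θ ^ 2 / 2)) ≤ 1 * Y := by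
    refine ge_of_tendsto hlim ?_
    filter_upwards [Ioc_mem_nhdsGT (zero_lt_one' ℝ)] with p hp using h1 p hp
  rw [one_mul, ← Real.exp_add] at h2
  have h3 : X ≤ Y * Real.exp (-(θ * r + θ ^ 2 / 2)) := by
    rw [Real.exp_neg, ← div_eq_mul_inv, le_div_iff₀ (Real.exp_pos _)]
    exact h2
  refine h3.trans (le_of_eq ?_)
  rw [hY, ← Real.exp_add]
  congr 1; ring

end Chevet

/-! ### Variational bounds for the extreme singular values. -/

section SingularValues

variable {E F : Type*} [NormedAddCommGroup E] [InnerProductSpace ℝ E] [FiniteDimensional ℝ E]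
  [NormedAddCommGroup F] [InnerProductSpace ℝ F] [FiniteDimensional ℝ F] (T : E →ₗ[ℝ] F)

/-- Expansion of x in an orthonormal eigenbasis of T*T; both extreme bounds follow by comparing each
coefficient with the first or the last singular value. -/
theorem norm_sq_eq_sum_singularValues {m : ℕ} (hm : Module.finrank ℝ E = m) (x : E) :
    ‖T x‖ ^ 2 = ∑ i : Fin m, T.singularValues i ^ 2 *
      inner ℝ (T.isSymmetric_adjoint_comp_self.eigenvectorBasis hm i) x ^ 2 := by
  set hT := T.isSymmetric_adjoint_comp_self
  have h1 : ‖T x‖ ^ 2 = inner ℝ x ((LinearMap.adjoint T ∘ₗ T) x) := by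
    rw [LinearMap.comp_apply, LinearMap.adjoint_inner_right, real_inner_self_eq_norm_sq]
  rw [h1, ← (hT.eigenvectorBasis hm).sum_inner_mul_inner x]
  refine Finset.sum_congr rfl fun i _ => ?_
  rw [← hT, hT.apply_eigenvectorBasis, T.sq_singularValues_fin hm, real_inner_smul_left,
    real_inner_comm x]
  simp only [RCLike.ofReal_real_eq_id, id_eq]
  ring

theorem norm_eigenvectorBasis_apply {m : ℕ} (hm : Module.finrank ℝ E = m) (i : Fin m) :
    ‖T (T.isSymmetric_adjoint_comp_self.eigenvectorBasis hm i)‖ = T.singularValues i := by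
  have h := norm_sq_eq_sum_singularValues T hm
    (T.isSymmetric_adjoint_comp_self.eigenvectorBasis hm i)
  rw [Finset.sum_eq_single i] at h
  · rw [real_inner_self_eq_norm_sq, OrthonormalBasis.norm_eq_one] at h
    refine (sq_eq_sq₀ (norm_nonneg _) (T.singularValues_nonneg i)).1 (by simpa using h)
  · intro j _ hj
    rw [(OrthonormalBasis.orthonormal _).inner_eq_zero hj]; ring
  · simp

theorem norm_apply_le_singularValues_zero (x : E) : ‖T x‖ ≤ T.singularValues 0 * ‖x‖ := by
  refine le_of_sq_le_sq ?_ (mul_nonneg (T.singularValues_nonneg 0) (norm_nonneg x))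
  rw [norm_sq_eq_sum_singularValues T rfl x, mul_pow,
    ← (T.isSymmetric_adjoint_comp_self.eigenvectorBasis rfl).sum_sq_norm_inner_right x,
    Finset.mul_sum]
  refine Finset.sum_le_sum fun i _ => ?_
  rw [Real.norm_eq_abs, sq_abs]
  refine mul_le_mul_of_nonneg_right ?_ (sq_nonneg _)
  exact pow_le_pow_left₀ (T.singularValues_nonneg _) (T.singularValues_antitone (Nat.zero_le _)) 2

theorem singularValues_pred_mul_norm_le (x : E) :
    T.singularValues (Module.finrank ℝ E - 1) * ‖x‖ ≤ ‖T x‖ := by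
  refine le_of_sq_le_sq ?_ (norm_nonneg _)
  rw [norm_sq_eq_sum_singularValues T rfl x, mul_pow,
    ← (T.isSymmetric_adjoint_comp_self.eigenvectorBasis rfl).sum_sq_norm_inner_right x,
    Finset.mul_sum]
  refine Finset.sum_le_sum fun i _ => ?_
  rw [Real.norm_eq_abs, sq_abs]
  refine mul_le_mul_of_nonneg_right ?_ (sq_nonneg _)
  exact pow_le_pow_left₀ (T.singularValues_nonneg _)
    (T.singularValues_antitone (by have := i.2; omega)) 2

end SingularValues

/-! ### Extreme singular values of matrices. -/

section Matrices

variable {ι : Type*} [Fintype ι] {m : ℕ}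

theorem sMax_le_iff (hm : 0 < m) (F : Matrix ι (Fin m) ℝ) (c : ℝ) :
    sMax F ≤ c ↔ ∀ x, ‖Matrix.toEuclideanLin F x‖ ≤ c * ‖x‖ := by
  constructor
  · intro h x
    exact (norm_apply_le_singularValues_zero _ x).trans
      (mul_le_mul_of_nonneg_right h (norm_nonneg x))
  · intro h
    have hf : Module.finrank ℝ (EuclideanSpace ℝ (Fin m)) = m := by simp
    have := norm_eigenvectorBasis_apply (Matrix.toEuclideanLin F) hf ⟨0, hm⟩
    have h2 := h ((Matrix.toEuclideanLin F).isSymmetric_adjoint_comp_self.eigenvectorBasis hf ⟨0, hm⟩)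
    rw [this, OrthonormalBasis.norm_eq_one, mul_one] at h2
    exact h2

theorem le_sMin_iff (hm : 0 < m) (F : Matrix ι (Fin m) ℝ) (c : ℝ) :
    c ≤ sMin F ↔ ∀ x, c * ‖x‖ ≤ ‖Matrix.toEuclideanLin F x‖ := by
  have hf : Module.finrank ℝ (EuclideanSpace ℝ (Fin m)) = m := by simp
  constructor
  · intro h x
    have := singularValues_pred_mul_norm_le (Matrix.toEuclideanLin F) x
    rw [hf] at this
    exact (mul_le_mul_of_nonneg_right h (norm_nonneg x)).trans this
  · intro h
    have := norm_eigenvectorBasis_apply (Matrix.toEuclideanLin F) hf ⟨m - 1, by omega⟩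
    have h2 := h ((Matrix.toEuclideanLin F).isSymmetric_adjoint_comp_self.eigenvectorBasis hf
      ⟨m - 1, by omega⟩)
    rw [this, OrthonormalBasis.norm_eq_one, mul_one] at h2
    exact h2

theorem sMax_nonneg (F : Matrix ι (Fin m) ℝ) : 0 ≤ sMax F :=
  LinearMap.singularValues_nonneg _ _

end Matrices

/-! ### Nets of the unit sphere by volume comparison. -/

section Nets

variable {E : Type*} [NormedAddCommGroup E] [NormedSpace ℝ E] [FiniteDimensional ℝ E]

/-- The balls of radius ε/2 about the points are disjoint and lie in the ball of radius 1 + ε/2;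
compare volumes. -/
theorem card_le_of_separated_ball {ε : ℝ} (hε : 0 < ε) (s : Finset E) (hs : ∀ c ∈ s, ‖c‖ ≤ 1)
    (h : ∀ c ∈ s, ∀ d ∈ s, c ≠ d → ε ≤ ‖c - d‖) :
    (s.card : ℝ) ≤ (1 + 2 * ε⁻¹) ^ Module.finrank ℝ E := by
  borelize E
  let μ : Measure E := Measure.addHaar
  set δ : ℝ := ε / 2 with hδ
  have δpos : 0 < δ := by positivity
  have ρpos : 0 < 1 + δ := by positivity
  have D : Set.Pairwise (s : Set E) (Function.onFun Disjoint fun c => Metric.ball (c : E) δ) := by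
    rintro c hc d hd hcd
    apply Metric.ball_disjoint_ball
    rw [dist_eq_norm, hδ, add_halves]
    exact h c hc d hd hcd
  have A_subset : (⋃ c ∈ s, Metric.ball (c : E) δ) ⊆ Metric.ball (0 : E) (1 + δ) := by
    refine Set.iUnion₂_subset fun x hx => ?_
    apply Metric.ball_subset_ball'
    rw [dist_zero_right]
    linarith [hs x hx]
  have I : (s.card : ENNReal) * ENNReal.ofReal (δ ^ Module.finrank ℝ E) * μ (Metric.ball 0 1) ≤
      ENNReal.ofReal ((1 + δ) ^ Module.finrank ℝ E) * μ (Metric.ball 0 1) :=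
    calc
      (s.card : ENNReal) * ENNReal.ofReal (δ ^ Module.finrank ℝ E) * μ (Metric.ball 0 1)
          = μ (⋃ c ∈ s, Metric.ball (c : E) δ) := by
        rw [measure_biUnion_finset D fun c _ => measurableSet_ball]
        simp only [μ.addHaar_ball_of_pos _ δpos, Finset.sum_const, nsmul_eq_mul, mul_assoc]
      _ ≤ μ (Metric.ball (0 : E) (1 + δ)) := measure_mono A_subset
      _ = ENNReal.ofReal ((1 + δ) ^ Module.finrank ℝ E) * μ (Metric.ball 0 1) := by
        simp only [μ.addHaar_ball_of_pos _ ρpos]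
  have J : (s.card : ENNReal) * ENNReal.ofReal (δ ^ Module.finrank ℝ E) ≤
      ENNReal.ofReal ((1 + δ) ^ Module.finrank ℝ E) :=
    (ENNReal.mul_le_mul_iff_left (Metric.measure_ball_pos _ _ zero_lt_one).ne'
      measure_ball_lt_top.ne).1 I
  have K := ENNReal.toReal_le_of_le_ofReal (pow_nonneg ρpos.le _) J
  rw [ENNReal.toReal_mul, ENNReal.toReal_natCast, ENNReal.toReal_ofReal (by positivity),
    ← le_div_iff₀ (by positivity), ← div_pow] at K
  refine K.trans (le_of_eq ?_)
  congr 1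
  rw [hδ]
  field_simp
  ring

/-- An `ε`-net of the unit sphere with at most `(1 + 2 / ε) ^ dim` points. -/
theorem exists_sphere_net (E : Type*) [NormedAddCommGroup E] [NormedSpace ℝ E]
    [FiniteDimensional ℝ E] {ε : ℝ} (hε : 0 < ε) :
    ∃ t : Finset E, (∀ x ∈ t, ‖x‖ = 1) ∧ (t.card : ℝ) ≤ (1 + 2 * ε⁻¹) ^ Module.finrank ℝ E ∧
      ∀ x : E, ‖x‖ = 1 → ∃ y ∈ t, ‖x - y‖ ≤ ε := by
  classical
  -- A separated set of maximal cardinality is a net, since an uncovered point could be added to it.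
  -- The volume bound makes the maximum exist.
  let S : Set ℕ := {n | ∃ t : Finset E, (∀ x ∈ t, ‖x‖ = 1) ∧
    (∀ c ∈ t, ∀ d ∈ t, c ≠ d → ε ≤ ‖c - d‖) ∧ t.card = n}
  have hne : S.Nonempty := ⟨0, ∅, by simp, by simp, rfl⟩
  have hbd : BddAbove S := by
    refine ⟨⌈(1 + 2 * ε⁻¹) ^ Module.finrank ℝ E⌉₊, ?_⟩
    rintro n ⟨t, h1, h2, rfl⟩
    exact_mod_cast (card_le_of_separated_ball hε t (fun c hc => (h1 c hc).le) h2).trans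
      (Nat.le_ceil _)
  obtain ⟨t, h1, h2, h3⟩ := Nat.sSup_mem hne hbd
  refine ⟨t, h1, card_le_of_separated_ball hε t (fun c hc => (h1 c hc).le) h2, fun x hx => ?_⟩
  by_contra! hcon
  have hxt : x ∉ t := fun h => by have := hcon x h; simp at this; linarith
  have : (insert x t).card ∈ S := by
    refine ⟨insert x t, ?_, ?_, rfl⟩
    · intro y hy
      rcases Finset.mem_insert.1 hy with rfl | hy
      · exact hx
      · exact h1 y hy
    · intro c hc d hd hcd
      rcases Finset.mem_insert.1 hc with hc' | hc' <;> rcases Finset.mem_insert.1 hd with hd' | hd'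
      · exact absurd (hc'.trans hd'.symm) hcd
      · rw [hc']; exact (hcon d hd').le
      · rw [hd', norm_sub_rev]; exact (hcon c hc').le
      · exact h2 c hc' d hd' hcd
  have := le_csSup hbd this
  rw [Finset.card_insert_of_notMem hxt, h3] at this
  omega

end Nets

/-! ### Upper tail of the largest singular value. -/

section OperatorNorm

variable {ι : Type*} [Fintype ι] {m : ℕ}

theorem inner_toEuclideanLin (F : Matrix ι (Fin m) ℝ) (y : EuclideanSpace ℝ ι)
    (x : EuclideanSpace ℝ (Fin m)) :
    inner ℝ y (Matrix.toEuclideanLin F x) = ∑ q : ι × Fin m, y q.1 * x q.2 * F q.1 q.2 := by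
  rw [Fintype.sum_prod_type, PiLp.inner_apply]
  refine Finset.sum_congr rfl fun i _ => ?_
  simp only [Matrix.toLpLin_apply, Matrix.mulVec, dotProduct, RCLike.inner_apply, conj_trivial,
    Finset.sum_mul]
  exact Finset.sum_congr rfl fun j _ => by ring

theorem sum_sq_eq_one {J : Type*} [Fintype J] {x : EuclideanSpace ℝ J} (hx : ‖x‖ = 1) :
    ∑ i, x i ^ 2 = 1 := by
  have := EuclideanSpace.real_norm_sq_eq x
  rw [hx] at this; linarith

/-- If the bilinear form of `F` is at most `r` on a product of `δ`-nets, then `sMax F` is at most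
`r / (1 - 2 δ)`. -/
theorem sMax_mul_le_of_net (hm : 0 < m) (F : Matrix ι (Fin m) ℝ) {δ r : ℝ} (hr : 0 ≤ r)
    {s : Finset (EuclideanSpace ℝ ι)} {t : Finset (EuclideanSpace ℝ (Fin m))}
    (hs1 : ∀ y ∈ s, ‖y‖ = 1)
    (hs : ∀ y, ‖y‖ = 1 → ∃ z ∈ s, ‖y - z‖ ≤ δ) (ht : ∀ x, ‖x‖ = 1 → ∃ z ∈ t, ‖x - z‖ ≤ δ)
    (h : ∀ y ∈ s, ∀ x ∈ t, inner ℝ y (Matrix.toEuclideanLin F x) ≤ r) :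
    (1 - 2 * δ) * sMax F ≤ r := by
  set T := Matrix.toEuclideanLin F
  have hK := (sMax_le_iff hm F _).1 le_rfl
  have h0 := sMax_nonneg F
  have hin : ∀ y x, ‖y‖ = 1 → ‖x‖ = 1 → inner ℝ y (T x) ≤ r + 2 * δ * sMax F := by
    intro y x hy hx
    obtain ⟨y', hy', hyd⟩ := hs y hy
    obtain ⟨x', hx', hxd⟩ := ht x hx
    have e : inner ℝ y (T x) = inner ℝ y' (T x') + inner ℝ (y - y') (T x) +
        inner ℝ y' (T (x - x')) := by
      rw [map_sub, inner_sub_left, inner_sub_right]; ring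
    have b1 : inner ℝ (y - y') (T x) ≤ δ * sMax F := by
      refine (real_inner_le_norm _ _).trans (mul_le_mul hyd ?_ (norm_nonneg _)
        ((norm_nonneg _).trans hyd))
      simpa [hx] using hK x
    have b2 : inner ℝ y' (T (x - x')) ≤ δ * sMax F := by
      refine (real_inner_le_norm _ _).trans ?_
      rw [hs1 y' hy', one_mul, mul_comm]
      exact (hK _).trans (mul_le_mul_of_nonneg_left hxd h0)
    rw [e]; linarith [h y' hy' x' hx']
  -- A negative δ cannot occur: the unit sphere is nonempty because m > 0.
  have hδ : 0 ≤ r + 2 * δ * sMax F := by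
    by_cases hδ0 : 0 ≤ δ
    · positivity
    · have : Subsingleton (EuclideanSpace ℝ (Fin m)) := by
        by_contra hns
        rw [not_subsingleton_iff_nontrivial] at hns
        obtain ⟨x, hx⟩ := exists_norm_eq (EuclideanSpace ℝ (Fin m)) zero_le_one
        obtain ⟨z, -, hz⟩ := ht x hx
        exact hδ0 ((norm_nonneg _).trans hz)
      have h1 : Module.finrank ℝ (EuclideanSpace ℝ (Fin m)) = 0 :=
        Module.finrank_zero_of_subsingleton
      simp at h1; omega
  have : sMax F ≤ r + 2 * δ * sMax F := by
    rw [sMax_le_iff hm]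
    have hunit : ∀ x, ‖x‖ = 1 → ‖T x‖ ≤ r + 2 * δ * sMax F := by
      intro x hx
      by_cases hTx : T x = 0
      · rw [hTx, norm_zero]; exact hδ
      · have hn : ‖T x‖ ≠ 0 := norm_ne_zero_iff.2 hTx
        have := hin (‖T x‖⁻¹ • T x) x (by rw [norm_smul, norm_inv, norm_norm, inv_mul_cancel₀ hn]) hx
        rwa [real_inner_smul_left, real_inner_self_eq_norm_sq, sq, inv_mul_cancel_left₀ hn] at this
    intro x
    by_cases hx : x = 0
    · simp [hx]
    · have hn : ‖x‖ ≠ 0 := norm_ne_zero_iff.2 hx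
      have := hunit (‖x‖⁻¹ • x) (by rw [norm_smul, norm_inv, norm_norm, inv_mul_cancel₀ hn])
      rw [map_smul, norm_smul, norm_inv, norm_norm, inv_mul_le_iff₀ (by positivity)] at this
      rw [mul_comm]; exact this
  linarith

/-- The largest singular value of a Gaussian matrix has the sharp sub-Gaussian upper tail. -/
theorem measureReal_sMax_gt_le [Nonempty ι] (hm : 0 < m) {θ : ℝ} (hθ : 0 ≤ θ) :
    (gaussPi (ι × Fin m)).real
      {B | √(Fintype.card ι) + √m + θ < sMax (Matrix.of fun i j => B (i, j))} ≤
      Real.exp (-(θ ^ 2 / 2)) := by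
  have : Nonempty (Fin m) := ⟨⟨0, hm⟩⟩
  set s : ℝ := √(Fintype.card ι) + √m + θ with hs
  have hs0 : 0 ≤ s := by positivity
  -- The net sizes do not enter the bound, so δ → 0 below recovers the sharp exponent.
  have key : ∀ δ ∈ Set.Ioo (0 : ℝ) (1 / 2), (gaussPi (ι × Fin m)).real
      {B | s < sMax (Matrix.of fun i j => B (i, j))} ≤
      Real.exp (θ * (√(Fintype.card ι) + √m - (1 - 2 * δ) * s) + θ ^ 2 / 2) := by
    intro δ hδ
    obtain ⟨S, hS1, -, hS⟩ := exists_sphere_net (EuclideanSpace ℝ ι) hδ.1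
    obtain ⟨t, ht1, -, ht⟩ := exists_sphere_net (EuclideanSpace ℝ (Fin m)) hδ.1
    obtain ⟨y0, hy0⟩ := exists_norm_eq (EuclideanSpace ℝ ι) zero_le_one
    obtain ⟨x0, hx0⟩ := exists_norm_eq (EuclideanSpace ℝ (Fin m)) zero_le_one
    obtain ⟨y1, hy1, -⟩ := hS y0 hy0
    obtain ⟨x1, hx1, -⟩ := ht x0 hx0
    have : Nonempty (S × t) := ⟨(⟨y1, hy1⟩, ⟨x1, hx1⟩)⟩
    have := measureReal_bilin_ge_le (I := S × t) (r := (1 - 2 * δ) * s) hθ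
      (fun p => (p.1 : EuclideanSpace ℝ ι)) (fun p => (p.2 : EuclideanSpace ℝ (Fin m)))
      (fun p => sum_sq_eq_one (hS1 _ p.1.2)) (fun p => sum_sq_eq_one (ht1 _ p.2.2))
    rw [Fintype.card_fin] at this
    refine le_trans (measureReal_mono fun B hB => ?_) this
    rw [Set.mem_ofPred_eq] at hB ⊢
    by_contra! hcon
    have hd : 0 < 1 - 2 * δ := by linarith [hδ.2]
    have := sMax_mul_le_of_net hm (Matrix.of fun i j => B (i, j)) (r := (1 - 2 * δ) * s)
      (by positivity) hS1 hS ht (fun y hy x hx => by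
        rw [inner_toEuclideanLin]
        exact (hcon (⟨y, hy⟩, ⟨x, hx⟩)).le)
    exact absurd (le_of_mul_le_mul_left this hd) (not_le.2 hB)
  have hlim : Tendsto (fun δ : ℝ =>
      Real.exp (θ * (√(Fintype.card ι) + √m - (1 - 2 * δ) * s) + θ ^ 2 / 2)) (𝓝[>] 0)
      (𝓝 (Real.exp (θ * (√(Fintype.card ι) + √m - (1 - 2 * 0) * s) + θ ^ 2 / 2))) := by
    refine Tendsto.mono_left ?_ nhdsWithin_le_nhds
    exact Continuous.tendsto (by fun_prop) 0
  have h2 := ge_of_tendsto hlim (by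
    filter_upwards [Ioo_mem_nhdsGT (by norm_num : (0 : ℝ) < 1 / 2)] with δ hδ using key δ hδ)
  refine h2.trans (le_of_eq ?_)
  congr 1; rw [hs]; ring

end OperatorNorm

/-! ### Lower tail of the norm of a Gaussian image vector. -/

section LowerTail

variable {ι J : Type*} [Fintype ι] [Fintype J]

theorem measurePreserving_curry_gaussPi :
    MeasurePreserving (MeasurableEquiv.curry ι J ℝ) (gaussPi (ι × J))
      (Measure.pi fun _ : ι => gaussPi J) := by
  refine ⟨(MeasurableEquiv.curry ι J ℝ).measurable, ?_⟩
  have := Measure.infinitePi_map_curry (fun (_ : ι) (_ : J) => gaussianReal 0 1)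
  simpa only [Measure.infinitePi_eq_pi] using this

/-- A one-dimensional marginal of the standard Gaussian along a unit vector is standard normal. -/
theorem measurePreserving_sum_mul {x : J → ℝ} (hx : ∑ j, x j ^ 2 = 1) :
    MeasurePreserving (fun y : J → ℝ => ∑ j, y j * x j) (gaussPi J) (gaussianReal 0 1) := by
  refine ⟨by fun_prop, ?_⟩
  let X : EuclideanSpace ℝ J := WithLp.toLp 2 x
  have hX : ‖X‖ = 1 := by
    rw [EuclideanSpace.norm_eq]
    simp [X, hx]
  have h1 := (isGaussian_stdGaussian (E := EuclideanSpace ℝ J)).map_eq_gaussianReal (innerSL ℝ X)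
  rw [integral_strongDual_stdGaussian, variance_dual_stdGaussian, innerSL_apply_norm, hX,
    ← map_pi_eq_stdGaussian, Measure.map_map (by fun_prop) (by fun_prop)] at h1
  have e : (innerSL ℝ X) ∘ (WithLp.toLp 2 : (J → ℝ) → EuclideanSpace ℝ J) =
      fun y => ∑ j, y j * x j := by
    ext y
    simp [X, PiLp.inner_apply]
  rw [e] at h1
  rw [h1]
  congr 1
  simp

theorem integral_prod_rows {x : J → ℝ} (hx : ∑ j, x j ^ 2 = 1) {f : ℝ → ℝ} (hf : Continuous f) :
    ∫ B, ∏ i, f (∑ j, B (i, j) * x j) ∂gaussPi (ι × J) =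
      (∫ s, f s ∂gaussianReal 0 1) ^ Fintype.card ι := by
  have h1 : ∫ B, ∏ i, f (∑ j, B (i, j) * x j) ∂gaussPi (ι × J) =
      ∫ C : ι → J → ℝ, ∏ i, f (∑ j, C i j * x j) ∂Measure.pi fun _ : ι => gaussPi J := by
    rw [← (measurePreserving_curry_gaussPi (ι := ι) (J := J)).integral_comp']
    rfl
  rw [h1, integral_fintype_prod_eq_pow (fun y : J → ℝ => f (∑ j, y j * x j))]
  congr 1
  have mp := measurePreserving_sum_mul hx
  rw [← mp.map_eq, integral_map mp.measurable.aemeasurable hf.aestronglyMeasurable]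

/-- Chernoff's bound for the lower tail of `‖B x‖²`, where `B` is a Gaussian matrix and `x` a unit
vector. -/
theorem measureReal_sum_sq_le {x : J → ℝ} (hx : ∑ j, x j ^ 2 = 1) {y z : ℝ} (hy : 0 < y)
    (hy1 : y ≤ 1) (hyz : y * Real.exp (-y) = Real.exp (-(2 * z) - 6 / 5)) :
    (gaussPi (ι × J)).real {B | ∑ i, (∑ j, B (i, j) * x j) ^ 2 ≤ Fintype.card ι * y} ≤
      Real.exp (-(Fintype.card ι * z)) := by
  -- The optimal Chernoff parameter for the threshold Ny: it minimises (1 - 2a)^(-N/2) exp(-aNy).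
  set a : ℝ := (1 - y⁻¹) / 2 with ha
  have hyi : 1 ≤ y⁻¹ := (one_le_inv₀ hy).2 hy1
  have ha0 : a ≤ 0 := by rw [ha]; linarith
  have ha1 : 1 - 2 * a = y⁻¹ := by rw [ha]; ring
  let G : (ι × J → ℝ) → ℝ := fun B => ∏ i, Real.exp (a * (∑ j, B (i, j) * x j) ^ 2)
  have hG0 : ∀ B, 0 ≤ G B := fun B => Finset.prod_nonneg fun _ _ => (Real.exp_pos _).le
  have hGv : ∫ B, G B ∂gaussPi (ι × J) = √y ^ Fintype.card ι := by
    have := integral_prod_rows (ι := ι) hx (f := fun s => Real.exp (a * s ^ 2)) (by fun_prop)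
    rw [integral_exp_mul_sq_gaussianReal (by linarith), ha1, Real.sqrt_inv, inv_inv] at this
    exact this
  have hGi : Integrable G (gaussPi (ι × J)) := by
    refine Integrable.of_integral_ne_zero ?_
    rw [hGv]; positivity
  have hmk := mul_meas_ge_le_integral_of_nonneg (Eventually.of_forall hG0) hGi
    (Real.exp (a * (Fintype.card ι * y)))
  rw [hGv] at hmk
  have hsub : {B : ι × J → ℝ | ∑ i, (∑ j, B (i, j) * x j) ^ 2 ≤ Fintype.card ι * y} ⊆
      {B | Real.exp (a * (Fintype.card ι * y)) ≤ G B} := by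
    intro B hB
    rw [Set.mem_ofPred_eq] at hB ⊢
    simp only [G]
    rw [← Real.exp_sum, ← Finset.mul_sum]
    exact Real.exp_le_exp.2 (mul_le_mul_of_nonpos_left hB ha0)
  have h1 : (gaussPi (ι × J)).real {B | ∑ i, (∑ j, B (i, j) * x j) ^ 2 ≤ Fintype.card ι * y} ≤
      √y ^ Fintype.card ι * Real.exp (-(a * (Fintype.card ι * y))) := by
    rw [Real.exp_neg, ← div_eq_mul_inv, le_div_iff₀ (Real.exp_pos _), mul_comm]
    exact (mul_le_mul_of_nonneg_left (measureReal_mono hsub) (Real.exp_pos _).le).trans hmk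
  have hlog : Real.log y = y - 2 * z - 6 / 5 := by
    have := congrArg Real.log hyz
    rw [Real.log_mul hy.ne' (Real.exp_pos _).ne', Real.log_exp, Real.log_exp] at this
    linarith
  have h2 : √y ^ Fintype.card ι = Real.exp (Fintype.card ι * (Real.log y / 2)) := by
    rw [← Real.log_sqrt hy.le, mul_comm, Real.exp_mul, Real.exp_log (Real.sqrt_pos.2 hy),
      Real.rpow_natCast]
  refine h1.trans ?_
  rw [h2, ← Real.exp_add]
  refine Real.exp_le_exp.2 ?_
  have e : a * (Fintype.card ι * y) = Fintype.card ι * ((y - 1) / 2) := by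
    rw [ha]; field_simp
  -- The exponent is now -Nz - N/10. The slack N/10 comes from 6/5, in whose place 1 would already
  -- suffice here.
  rw [e, hlog]
  have : (0 : ℝ) ≤ Fintype.card ι := by positivity
  nlinarith

end LowerTail

/-! ### The constants: Lambert function, entropy, positivity of P. -/

section Constants

/-- As z + 6/5 ≥ 1, the argument lies in the domain [-1/e, ∞) of W₀. The equation for y = -W₀ is the
one that Chernoff's bound requires. -/
theorem neg_lambertW0_spec {z : ℝ} (hz : 0 ≤ z) :
    0 < -lambertW0 (-Real.exp (-z - 6 / 5)) ∧ -lambertW0 (-Real.exp (-z - 6 / 5)) ≤ 1 ∧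
      -lambertW0 (-Real.exp (-z - 6 / 5)) * Real.exp (-(-lambertW0 (-Real.exp (-z - 6 / 5)))) =
        Real.exp (-z - 6 / 5) := by
  have h : -Real.exp (-1) ≤ -Real.exp (-z - 6 / 5) :=
    neg_le_neg (Real.exp_le_exp.2 (by linarith))
  obtain ⟨h1, h2⟩ := lambertW0_spec h
  set w := lambertW0 (-Real.exp (-z - 6 / 5))
  have h3 : -w * Real.exp (-(-w)) = Real.exp (-z - 6 / 5) := by rw [neg_neg, neg_mul, h2, neg_neg]
  refine ⟨?_, by linarith, h3⟩
  have := Real.exp_pos (-z - 6 / 5)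
  rw [← h3] at this
  exact pos_of_mul_pos_left this (Real.exp_pos _).le

theorem log_entropy {β : ℝ} (hβ : 0 < β) (hβ1 : β < 1) :
    Real.log (β ^ (-β) * (1 - β) ^ (-(1 - β))) =
      -β * Real.log β + -(1 - β) * Real.log (1 - β) := by
  have : 0 < 1 - β := by linarith
  rw [Real.log_mul (by positivity) (by positivity), Real.log_rpow hβ, Real.log_rpow this]

/-- One term of the binomial expansion of (β + (1 - β))^n is at most 1. -/
theorem choose_le_exp_entropy {β : ℝ} (hβ : 0 < β) (hβ1 : β < 1) {n k : ℕ} (hk : β * n = k) :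
    (n.choose k : ℝ) ≤ Real.exp (n * Real.log (β ^ (-β) * (1 - β) ^ (-(1 - β)))) := by
  have h1 : 0 < 1 - β := by linarith
  have hkn : k ≤ n := by
    have : (k : ℝ) ≤ n := by rw [← hk]; nlinarith [(Nat.cast_nonneg n : (0 : ℝ) ≤ n)]
    exact_mod_cast this
  have hbin := add_pow β (1 - β) n
  rw [add_sub_cancel, one_pow] at hbin
  have hterm : β ^ k * (1 - β) ^ (n - k) * n.choose k ≤ 1 := by
    refine le_trans ?_ hbin.symm.le
    exact Finset.single_le_sum (f := fun k => β ^ k * (1 - β) ^ (n - k) * (n.choose k : ℝ))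
      (fun _ _ => by positivity) (Finset.mem_range.2 (Nat.lt_succ_of_le hkn))
  have e : Real.exp (n * Real.log (β ^ (-β) * (1 - β) ^ (-(1 - β)))) =
      (β ^ k * (1 - β) ^ (n - k))⁻¹ := by
    rw [log_entropy hβ hβ1, ← Real.exp_log (by positivity : 0 < (β ^ k * (1 - β) ^ (n - k))⁻¹),
      Real.log_inv, Real.log_mul (by positivity) (by positivity), Real.log_pow, Real.log_pow,
      Nat.cast_sub hkn, ← hk]
    congr 1; ring
  rw [e, ← one_div, le_div_iff₀ (by positivity), mul_comm]
  exact hterm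

theorem alphaC_sub {ν lam β : ℝ} {m n : ℕ} (hm : 0 < m) (hlam : lam = 1 - (m : ℝ) / n) :
    (alphaC ν lam β - ν) * m = n * Real.log (β ^ (-β) * (1 - β) ^ (-(1 - β))) := by
  have : (m : ℝ) ≠ 0 := by positivity
  rw [alphaC, hlam, sub_sub_cancel, inv_div, add_sub_cancel_left]
  field_simp

theorem alphaC_pos {ν lam β : ℝ} (hν : 0 < ν) (hlam : lam < 1) (hβ : 0 < β) (hβ1 : β < 1) :
    0 < alphaC ν lam β := by
  have h1 : 0 < 1 - β := by linarith
  have h2 : 0 < 1 - lam := by linarith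
  have l1 := Real.log_neg hβ hβ1
  have l2 := Real.log_neg h1 (by linarith)
  have : 0 ≤ (1 - lam)⁻¹ * Real.log (β ^ (-β) * (1 - β) ^ (-(1 - β))) := by
    refine mul_nonneg (by positivity) ?_
    rw [log_entropy hβ hβ1]
    nlinarith
  rw [alphaC]; linarith

theorem one_sub_lamErased {lam β : ℝ} {m n : ℕ} (hβ1 : β < 1) (hlam : lam = 1 - (m : ℝ) / n) :
    1 - lamErased lam β = m / ((1 - β) * n) := by
  have h1 : 1 - β ≠ 0 := by linarith
  have : 1 - lamErased lam β = (1 - lam) / (1 - β) := by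
    rw [lamErased]; field_simp; ring
  rw [this, hlam, sub_sub_cancel, div_div, mul_comm (n : ℝ)]

theorem lt_muC {α ε : ℝ} (hε : 0 < ε) : α < muC α ε := by
  have : 0 < Real.log (1 + 2 * ε⁻¹) := Real.log_pos (by have := inv_pos.2 hε; linarith)
  rw [muC]; linarith

theorem rC_pos {α lam : ℝ} (hlam : lam < 1) : 0 < rC α lam := by
  have : 0 < 1 - lam := by linarith
  rw [rC]; positivity

theorem qC_eq (α lam : ℝ) : qC α lam =
    (1 - lam)⁻¹ * -lambertW0 (-Real.exp (-(2 * α * (1 - lam)) - 6 / 5)) := by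
  rw [qC, neg_mul, mul_neg]
  congr 4
  ring_nf

theorem qC_pos {α lam : ℝ} (hα : 0 ≤ α) (hlam : lam < 1) : 0 < qC α lam := by
  have : 0 < 1 - lam := by linarith
  rw [qC_eq]
  exact mul_pos (inv_pos.2 this) (neg_lambertW0_spec (by positivity)).1

theorem qC_le {α lam : ℝ} (hα : 0 ≤ α) (hlam : lam < 1) : qC α lam ≤ (1 - lam)⁻¹ := by
  have : 0 < 1 - lam := by linarith
  rw [qC_eq]
  exact mul_le_of_le_one_right (inv_pos.2 this).le (neg_lambertW0_spec (by positivity)).2.1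

/-- With y = -W₀ > 0, y ≥ y exp(-y), which is explicit, and the prefactor (1 - lam)⁻¹ is at least 1.
-/
theorem exp_le_sqrt_qC {α lam : ℝ} (hα : 0 ≤ α) (hlam : lam < 1) (hlam0 : 0 ≤ lam) :
    Real.exp (-(α * (1 - lam)) - 3 / 5) ≤ √(qC α lam) := by
  have h0 : 0 < 1 - lam := by linarith
  refine Real.le_sqrt_of_sq_le ?_
  obtain ⟨h1, -, h3⟩ := neg_lambertW0_spec (z := 2 * α * (1 - lam)) (by positivity)
  rw [qC_eq, ← Real.exp_nat_mul]
  have e : ((2 : ℕ) : ℝ) * (-(α * (1 - lam)) - 3 / 5) = -(2 * α * (1 - lam)) - 6 / 5 := by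
    push_cast; ring
  rw [e]
  refine h3.symm.le.trans ?_
  set y := -lambertW0 (-Real.exp (-(2 * α * (1 - lam)) - 6 / 5))
  have h4 : Real.exp (-y) ≤ 1 := Real.exp_le_one_iff.2 (by linarith)
  have h5 : 1 ≤ (1 - lam)⁻¹ := (one_le_inv₀ h0).2 (by linarith)
  nlinarith

theorem bddAbove_range_sqrt_qC_sub {α lam : ℝ} (hα : 0 ≤ α) (hlam : lam < 1) :
    BddAbove (Set.range fun ε : Set.Ioo (0 : ℝ) 1 =>
      √(qC (muC α ε) lam) - ε * rC (muC α ε) lam) := by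
  refine ⟨√(1 - lam)⁻¹, ?_⟩
  rintro _ ⟨ε, rfl⟩
  have h1 := Real.sqrt_le_sqrt (qC_le (hα.trans (lt_muC ε.2.1).le) hlam)
  have h2 := mul_pos ε.2.1 (rC_pos (α := muC α ε) hlam)
  simp only
  linarith

/-- For small `ε` the lower bound `√q - ε r` is positive, because `√q` decays at most like
`ε ^ (1 - lam)` while `r` grows only logarithmically. -/
theorem exists_mul_rC_lt_sqrt_qC {α lam : ℝ} (hlam : lam < 1) (hlam0 : 0 < lam) :
    ∃ ε ∈ Set.Ioo (0 : ℝ) 1, ε * rC (muC α ε) lam < √(qC (muC α ε) lam) := by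
  set K : ℝ := (1 - lam) ^ (-(1 / 2) : ℝ) + 1 with hK
  have hK0 : 0 < K := by have : 0 < 1 - lam := by linarith
                         positivity
  set D : ℝ := 3 * Real.exp (α + 3 / 5) * (K + 3) with hD
  have hD0 : 0 < D := by positivity
  -- L is the value of μ(ε), and ε is recovered from 1 + 2/ε = exp(L - α). The three lower bounds on
  -- L give ε < 1, L > 1, and DL < exp(lam L) through the quadratic term of the exponential.
  obtain ⟨L, hL⟩ := exists_gt (max (α + Real.log 3) (max 1 (2 * D / lam ^ 2)))
  obtain ⟨hL1, hL2⟩ := max_lt_iff.1 hL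
  obtain ⟨hL2, hL3⟩ := max_lt_iff.1 hL2
  have hx : 3 < Real.exp (L - α) := by
    rw [← Real.log_lt_iff_lt_exp (by norm_num)]; linarith
  set x := Real.exp (L - α) with hxdef
  have hx1 : 0 < x - 1 := by linarith
  set ε : ℝ := 2 / (x - 1) with hε
  have hε0 : 0 < ε := by positivity
  have hε1 : ε < 1 := by rw [hε, div_lt_one hx1]; linarith
  have hμ : muC α ε = L := by
    have : 1 + 2 * ε⁻¹ = x := by rw [hε]; field_simp; ring
    rw [muC, this, hxdef, Real.log_exp]; ring
  refine ⟨ε, ⟨hε0, hε1⟩, ?_⟩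
  rw [hμ]
  refine lt_of_lt_of_le ?_ (exp_le_sqrt_qC (by linarith) hlam hlam0.le)
  have hεx : ε ≤ 3 * Real.exp (-(L - α)) := by
    rw [Real.exp_neg, ← hxdef, hε, ← div_eq_mul_inv, div_le_div_iff₀ hx1 (by linarith)]
    linarith
  have hr : rC L lam ≤ (K + 3) * L := by
    have : √(2 * L) ≤ 2 * L := Real.sqrt_le_iff.2 ⟨by linarith, by nlinarith⟩
    rw [rC, ← hK]
    nlinarith
  have hq : D * L < Real.exp (lam * L) := by
    have h1 := Real.quadratic_le_exp_of_nonneg (mul_nonneg hlam0.le (by linarith : (0 : ℝ) ≤ L))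
    have h2 : 2 * D < L * lam ^ 2 := (div_lt_iff₀ (by positivity)).1 hL3
    have h3 : 0 < lam * L := by nlinarith
    nlinarith
  calc ε * rC L lam ≤ (3 * Real.exp (-(L - α))) * ((K + 3) * L) :=
        mul_le_mul hεx hr (rC_pos hlam).le (by positivity)
    _ = D * L * Real.exp (-L - 3 / 5) := by
        have : Real.exp (-(L - α)) = Real.exp (α + 3 / 5) * Real.exp (-L - 3 / 5) := by
          rw [← Real.exp_add]; congr 1; ring
        rw [this, hD]; ring
    _ < Real.exp (lam * L) * Real.exp (-L - 3 / 5) :=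
        mul_lt_mul_of_pos_right hq (Real.exp_pos _)
    _ = Real.exp (-(L * (1 - lam)) - 3 / 5) := by rw [← Real.exp_add]; congr 1; ring

theorem PC_pos {ν lam β : ℝ} (hα : 0 ≤ alphaC ν lam β) (h1 : lamErased lam β < 1)
    (h0 : 0 < lamErased lam β) : 0 < PC ν lam β := by
  obtain ⟨ε, hε, h⟩ := exists_mul_rC_lt_sqrt_qC h1 h0
  exact (sub_pos.2 h).trans_le (le_ciSup (bddAbove_range_sqrt_qC_sub hα h1) ⟨ε, hε⟩)

theorem RC_pos {ν lam β : ℝ} (h1 : lamErased lam β < 1) : 0 < RC ν lam β := rC_pos h1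

end Constants

/-! ### Almost sure nonsingularity of square Gaussian matrices. -/

section Nonsingular

theorem absolutelyContinuous_pi_fin {n : ℕ} {X : Fin n → Type*} [∀ i, MeasurableSpace (X i)]
    {μ ν : ∀ i, Measure (X i)} [∀ i, SigmaFinite (μ i)] [∀ i, SigmaFinite (ν i)]
    (h : ∀ i, μ i ≪ ν i) : Measure.pi μ ≪ Measure.pi ν := by
  induction n with
  | zero => rw [Measure.pi_of_empty, Measure.pi_of_empty]
  | succ n ih =>
    rw [← (measurePreserving_piFinSuccAbove μ 0).symm.map_eq,
      ← (measurePreserving_piFinSuccAbove ν 0).symm.map_eq]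
    exact ((h 0).prod (ih fun i => h _)).map (MeasurableEquiv.measurable _)

theorem gaussPi_absolutelyContinuous {κ : Type*} [Fintype κ] :
    gaussPi κ ≪ (volume : Measure (κ → ℝ)) := by
  let e := (Fintype.equivFin κ).symm
  rw [volume_pi, gaussPi, ← (measurePreserving_piCongrLeft (fun _ : κ => gaussianReal 0 1) e).map_eq,
    ← (measurePreserving_piCongrLeft (fun _ : κ => (volume : Measure ℝ)) e).map_eq]
  exact (absolutelyContinuous_pi_fin fun _ =>
    gaussianReal_absolutelyContinuous 0 one_ne_zero).map (MeasurableEquiv.measurable _)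

/-- On each line in the direction of the identity matrix the determinant is a monic characteristic
polynomial, with finitely many zeros; Fubini along these lines gives a null set. -/
theorem ae_volume_det_ne_zero (m : ℕ) :
    ∀ᵐ B : Fin m × Fin m → ℝ, (Matrix.of fun i j => B (i, j)).det ≠ 0 := by
  have hs : MeasurableSet {B : Fin m × Fin m → ℝ | (Matrix.of fun i j => B (i, j)).det ≠ 0} := by
    refine IsOpen.measurableSet (isOpen_ne_fun ?_ continuous_const)
    exact Continuous.matrix_det (by fun_prop)
  let L : ℝ →ₗ[ℝ] (Fin m × Fin m → ℝ) :=
    LinearMap.toSpanSingleton ℝ _ fun q => (1 : Matrix (Fin m) (Fin m) ℝ) q.1 q.2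
  refine ae_mem_of_ae_add_linearMap_mem L volume volume hs fun y => ?_
  set M : Matrix (Fin m) (Fin m) ℝ := Matrix.of fun i j => y (i, j)
  have hsub : {s : ℝ | ¬ (y + L s ∈
      {B : Fin m × Fin m → ℝ | (Matrix.of fun i j => B (i, j)).det ≠ 0})} ⊆
      {s | (-M).charpoly.IsRoot s} := by
    intro s hs
    simp only [Set.mem_ofPred_eq, not_not] at hs
    rw [Set.mem_ofPred_eq, Polynomial.IsRoot.def, Matrix.eval_charpoly, ← hs]
    congr 1
    ext i j
    simp [L, M, Matrix.scalar_apply, Matrix.one_apply, Matrix.diagonal_apply, add_comm]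
  exact ((Polynomial.finite_setOfPred_isRoot (Matrix.charpoly_monic _).ne_zero).subset hsub).measure_zero _

theorem ae_gaussPi_det_ne_zero (m : ℕ) :
    ∀ᵐ B ∂gaussPi (Fin m × Fin m), (Matrix.of fun i j => B (i, j)).det ≠ 0 :=
  gaussPi_absolutelyContinuous.ae_le (ae_volume_det_ne_zero m)

end Nonsingular

/-! ### Both extreme singular values of one submatrix. -/

section SubmatrixTail

variable {ι : Type*} [Fintype ι] {m : ℕ}

theorem norm_toEuclideanLin_sq (B : ι × Fin m → ℝ) (x : EuclideanSpace ℝ (Fin m)) :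
    ‖Matrix.toEuclideanLin (Matrix.of fun i j => B (i, j)) x‖ ^ 2 =
      ∑ i, (∑ j, B (i, j) * x j) ^ 2 := by
  rw [EuclideanSpace.real_norm_sq_eq]
  rfl

/-- If `F` is bounded below on an `ε`-net of the unit sphere, then it is bounded below. -/
theorem le_sMin_of_net (hm : 0 < m) (F : Matrix ι (Fin m) ℝ) {ε a b : ℝ}
    {t : Finset (EuclideanSpace ℝ (Fin m))} (ht : ∀ x, ‖x‖ = 1 → ∃ z ∈ t, ‖x - z‖ ≤ ε)
    (ha : ∀ z ∈ t, a ≤ ‖Matrix.toEuclideanLin F z‖) (hb : sMax F ≤ b) :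
    a - ε * b ≤ sMin F := by
  rw [le_sMin_iff hm]
  have hK := (sMax_le_iff hm F _).1 hb
  intro x
  by_cases hx : x = 0
  · simp [hx]
  have hn : ‖x‖ ≠ 0 := norm_ne_zero_iff.2 hx
  have hu : ‖‖x‖⁻¹ • x‖ = 1 := by rw [norm_smul, norm_inv, norm_norm, inv_mul_cancel₀ hn]
  obtain ⟨z, hz, hd⟩ := ht _ hu
  set w := ‖x‖⁻¹ • x
  have h1 : ‖Matrix.toEuclideanLin F (w - z)‖ ≤ ε * b := by
    refine (hK _).trans ?_
    rw [mul_comm]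
    exact mul_le_mul_of_nonneg_right hd ((sMax_nonneg F).trans hb)
  have h2 : a - ε * b ≤ ‖Matrix.toEuclideanLin F w‖ := by
    have := norm_sub_norm_le (Matrix.toEuclideanLin F z) (Matrix.toEuclideanLin F (z - w))
    rw [← map_sub, sub_sub_cancel] at this
    rw [← norm_neg, ← map_neg, neg_sub] at h1
    linarith [ha z hz]
  have h3 : ‖Matrix.toEuclideanLin F x‖ = ‖x‖ * ‖Matrix.toEuclideanLin F w‖ := by
    rw [map_smul, norm_smul, norm_inv, norm_norm, mul_inv_cancel_left₀ hn]
  rw [h3, mul_comm]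
  exact mul_le_mul_of_nonneg_left h2 (norm_nonneg x)

theorem rC_mono {α α' lam : ℝ} (h : α ≤ α') : rC α lam ≤ rC α' lam := by
  have := Real.sqrt_le_sqrt (by linarith : 2 * α ≤ 2 * α')
  rw [rC, rC]; linarith

/-- The extreme singular values of a Gaussian matrix with redundancy `lam`: up to probability
`2 exp (-α m)` they lie in `√m * [√q - ε r, R]`. -/
theorem measureReal_singularValues_le [Nonempty ι] (hm : 0 < m) {lam α ε : ℝ} (hα : 0 ≤ α)
    (hε : 0 < ε) (hlam : 1 - lam = m / Fintype.card ι) :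
    (gaussPi (ι × Fin m)).real {B | √m * rC α lam < sMax (Matrix.of fun i j => B (i, j)) ∨
      sMin (Matrix.of fun i j => B (i, j)) <
        √m * (√(qC (muC α ε) lam) - ε * rC (muC α ε) lam)} ≤ 2 * Real.exp (-(α * m)) := by
  set N := Fintype.card ι with hN
  have hN0 : (0 : ℝ) < N := by exact_mod_cast Fintype.card_pos
  have hm0 : (0 : ℝ) < m := by exact_mod_cast hm
  have hlam1 : 0 < 1 - lam := by rw [hlam]; positivity
  set μ := muC α ε with hμ
  have hμα : α < μ := lt_muC hε
  have hr : √m * rC α lam = √N + √m + √(2 * α * m) := by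
    have : (1 - lam) ^ (-(1 / 2) : ℝ) = √N / √m := by
      rw [Real.rpow_neg hlam1.le, ← Real.sqrt_eq_rpow, hlam, Real.sqrt_div hm0.le, inv_div]
    rw [rC, this, Real.sqrt_mul (by positivity) (m : ℝ)]
    have : √(m : ℝ) ≠ 0 := by positivity
    field_simp
  obtain ⟨t, ht1, htc, ht⟩ := exists_sphere_net (EuclideanSpace ℝ (Fin m)) hε
  rw [finrank_euclideanSpace_fin] at htc
  obtain ⟨hy0, hy1, hyz⟩ := neg_lambertW0_spec (z := 2 * μ * (1 - lam))
    (mul_nonneg (by linarith) hlam1.le)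
  have hq : m * qC μ lam = N * -lambertW0 (-Real.exp (-(2 * μ * (1 - lam)) - 6 / 5)) := by
    rw [qC_eq, hlam, inv_div]; field_simp
  set y := -lambertW0 (-Real.exp (-(2 * μ * (1 - lam)) - 6 / 5)) with hy
  set S₁ : Set (ι × Fin m → ℝ) :=
    {B | √N + √m + √(2 * α * m) < sMax (Matrix.of fun i j => B (i, j))} with hS₁
  set S₂ : EuclideanSpace ℝ (Fin m) → Set (ι × Fin m → ℝ) :=
    fun x => {B | ∑ i, (∑ j, B (i, j) * x j) ^ 2 ≤ N * y} with hS₂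
  have hsub : {B : ι × Fin m → ℝ | √m * rC α lam < sMax (Matrix.of fun i j => B (i, j)) ∨
      sMin (Matrix.of fun i j => B (i, j)) < √m * (√(qC μ lam) - ε * rC μ lam)} ⊆
      S₁ ∪ ⋃ x ∈ t, S₂ x := by
    intro B hB
    by_contra hcon
    simp only [Set.mem_union, Set.mem_iUnion, not_or, not_exists, hS₁, hS₂, Set.mem_ofPred_eq,
      not_lt, not_le] at hcon hB
    obtain ⟨h1, h2⟩ := hcon
    rw [← hr] at h1
    rcases hB with hB | hB
    · exact absurd h1 (not_le.2 hB)
    -- Since r(α) ≤ r(μ), the upper-tail event at level α also controls s_max in the net argument,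
    -- so no further event is needed.
    · have h3 := le_sMin_of_net hm _ ht (a := √m * √(qC μ lam)) (fun z hz => by
        rw [← Real.sqrt_mul hm0.le, hq]
        refine Real.sqrt_le_iff.2 ⟨norm_nonneg _, ?_⟩
        rw [norm_toEuclideanLin_sq]
        exact (h2 z hz).le) (h1.trans (mul_le_mul_of_nonneg_left (rC_mono hμα.le) (by positivity)))
      have h4 : √m * (√(qC μ lam) - ε * rC μ lam) =
        √m * √(qC μ lam) - ε * (√m * rC μ lam) := by ring
      rw [h4] at hB
      exact absurd h3 (not_le.2 hB)
  have hb1 : (gaussPi (ι × Fin m)).real S₁ ≤ Real.exp (-(α * m)) := by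
    refine (measureReal_sMax_gt_le hm (Real.sqrt_nonneg _)).trans (le_of_eq ?_)
    rw [Real.sq_sqrt (by positivity)]
    congr 1; ring
  have hb2 : ∀ x ∈ t, (gaussPi (ι × Fin m)).real (S₂ x) ≤ Real.exp (-(μ * m)) := by
    intro x hx
    refine (measureReal_sum_sq_le (sum_sq_eq_one (ht1 x hx)) (z := μ * (1 - lam)) hy0 hy1 ?_).trans
      (le_of_eq ?_)
    · rw [hyz]; congr 2; ring
    · rw [← hN, hlam]; congr 1; field_simp
  -- The logarithm in μ cancels the net cardinality exactly.
  have hb3 : (t.card : ℝ) * Real.exp (-(μ * m)) ≤ Real.exp (-(α * m)) := by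
    have hpos : 0 < 1 + 2 * ε⁻¹ := by positivity
    have e : (1 + 2 * ε⁻¹) ^ m = Real.exp (Real.log (1 + 2 * ε⁻¹) * m) := by
      rw [Real.exp_mul, Real.exp_log hpos, Real.rpow_natCast]
    refine (mul_le_mul_of_nonneg_right htc (Real.exp_pos _).le).trans (le_of_eq ?_)
    rw [e, ← Real.exp_add, hμ, muC]
    congr 1; ring
  calc _ ≤ (gaussPi (ι × Fin m)).real (S₁ ∪ ⋃ x ∈ t, S₂ x) := measureReal_mono hsub
    _ ≤ (gaussPi (ι × Fin m)).real S₁ + (gaussPi (ι × Fin m)).real (⋃ x ∈ t, S₂ x) :=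
        measureReal_union_le _ _
    _ ≤ Real.exp (-(α * m)) + ∑ x ∈ t, (gaussPi (ι × Fin m)).real (S₂ x) :=
        add_le_add hb1 (measureReal_biUnion_finset_le _ _)
    _ ≤ Real.exp (-(α * m)) + t.card * Real.exp (-(μ * m)) := by
        rw [← nsmul_eq_mul]
        exact add_le_add_right (Finset.sum_le_card_nsmul _ _ _ hb2) _
    _ ≤ 2 * Real.exp (-(α * m)) := by linarith

end SubmatrixTail

/-! ### Measurability of the extreme singular values. -/

section Measurability

variable {ι : Type*} [Fintype ι] {m : ℕ}

theorem continuous_norm_toEuclideanLin_apply (x : EuclideanSpace ℝ (Fin m)) :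
    Continuous fun F : Matrix ι (Fin m) ℝ => ‖Matrix.toEuclideanLin F x‖ := by
  refine Continuous.norm ((PiLp.continuous_toLp 2 _).comp ?_)
  exact Continuous.matrix_mulVec continuous_id continuous_const

theorem measurable_sMax_comp {Ω : Type*} [MeasurableSpace Ω] (hm : 0 < m)
    {f : Ω → Matrix ι (Fin m) ℝ} (hf : ∀ i j, Measurable fun ω => f ω i j) :
    Measurable fun ω => sMax (f ω) := by
  have h : Measurable fun B : ι → Fin m → ℝ => sMax (Matrix.of B) := by
    refine measurable_of_Iic fun c => ?_
    have : (fun B : ι → Fin m → ℝ => sMax (Matrix.of B)) ⁻¹' Set.Iic c =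
        ⋂ x, {B | ‖Matrix.toEuclideanLin (Matrix.of B) x‖ ≤ c * ‖x‖} := by
      ext B; simp [sMax_le_iff hm]
    rw [this]
    exact IsClosed.measurableSet (α := ι → Fin m → ℝ) (isClosed_iInter fun x =>
      isClosed_le (continuous_norm_toEuclideanLin_apply x) continuous_const)
  exact h.comp (measurable_pi_lambda _ fun i => measurable_pi_lambda _ fun j => hf i j)

theorem measurable_sMin_comp {Ω : Type*} [MeasurableSpace Ω] (hm : 0 < m)
    {f : Ω → Matrix ι (Fin m) ℝ} (hf : ∀ i j, Measurable fun ω => f ω i j) :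
    Measurable fun ω => sMin (f ω) := by
  have h : Measurable fun B : ι → Fin m → ℝ => sMin (Matrix.of B) := by
    refine measurable_of_Ici fun c => ?_
    have : (fun B : ι → Fin m → ℝ => sMin (Matrix.of B)) ⁻¹' Set.Ici c =
        ⋂ x, {B | c * ‖x‖ ≤ ‖Matrix.toEuclideanLin (Matrix.of B) x‖} := by
      ext B; simp [le_sMin_iff hm]
    rw [this]
    exact IsClosed.measurableSet (α := ι → Fin m → ℝ) (isClosed_iInter fun x =>
      isClosed_le continuous_const (continuous_norm_toEuclideanLin_apply x))
  exact h.comp (measurable_pi_lambda _ fun i => measurable_pi_lambda _ fun j => hf i j)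

end Measurability

/-! ### Reformulation of the frame property. -/

section Frames

variable {n m : ℕ}

theorem linearIndependent_rows_iff_det_ne_zero (F : Matrix (Fin n) (Fin m) ℝ)
    {S : Finset (Fin n)} (e : Fin m ≃ S) :
    LinearIndependent ℝ (fun i : S => F i) ↔
      (Matrix.of fun i j => F (e i) j : Matrix (Fin m) (Fin m) ℝ).det ≠ 0 := by
  rw [← isUnit_iff_ne_zero, ← Matrix.isUnit_iff_isUnit_det,
    ← Matrix.linearIndependent_rows_iff_isUnit]
  exact (linearIndependent_equiv e (f := fun i : S => F i)).symm

theorem span_eq_top_of_linearIndependent (F : Matrix (Fin n) (Fin m) ℝ)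
    {S : Finset (Fin n)} (hS : S.card = m) (h : LinearIndependent ℝ (fun i : S => F i)) :
    Submodule.span ℝ (Set.range fun i : S => F i) = ⊤ :=
  h.span_eq_top_of_card_eq_finrank' (by simp [hS])

/-- A matrix all of whose `m`-row subfamilies are independent is a NERF as soon as the relevant
condition numbers are bounded. -/
theorem isNERF_iff (hmn : m < n) {β C : ℝ} (hβ : β ∈ Set.Ioo (0 : ℝ) 1)
    (hβn : ∃ k : ℕ, β * n = k) (hC : 0 < C) (F : Matrix (Fin n) (Fin m) ℝ) :
    IsNERF F β C ↔
      (∀ S : Finset (Fin n), S.card = m → LinearIndependent ℝ (fun i : S => F i)) ∧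
      ∀ T : Finset (Fin n), ((Tᶜ).card : ℝ) = β * n →
        0 < sMin (rowSubmatrix F T) ∧ sMax (rowSubmatrix F T) ≤ C * sMin (rowSubmatrix F T) := by
  constructor
  · intro h
    refine ⟨fun S hS => (h.basis S hS).1, fun T hT => ?_⟩
    obtain ⟨h1, h2⟩ := h.cond_le T hT
    exact ⟨h1, (div_le_iff₀ h1).1 h2⟩
  · rintro ⟨h1, h2⟩
    refine ⟨hmn, ?_, fun S hS => ⟨h1 S hS, span_eq_top_of_linearIndependent F hS (h1 S hS)⟩, hβ,
      hβn, hC, fun T hT => ⟨(h2 T hT).1, (div_le_iff₀ (h2 T hT).1).2 (h2 T hT).2⟩⟩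
    obtain ⟨S, -, hS⟩ := Finset.exists_subset_card_eq (s := (Finset.univ : Finset (Fin n)))
      (n := m) (by simpa using hmn.le)
    rw [eq_top_iff, ← span_eq_top_of_linearIndependent F hS (h1 S hS)]
    refine Submodule.span_mono ?_
    rintro _ ⟨i, rfl⟩
    exact ⟨i, rfl⟩

end Frames

/-! ### The event of a bad submatrix, and measurability of the frame event. -/

section BadEvent

variable {Ω : Type*} {m n : ℕ} {A : Ω → Matrix (Fin n) (Fin m) ℝ}

/-- The event that some submatrix obtained by erasing `k` rows has an extreme singular value
outside `[√m c, √m R]`. -/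
def badEvent (A : Ω → Matrix (Fin n) (Fin m) ℝ) (k : ℕ) (R c : ℝ) : Set Ω :=
  {ω | ∃ T : Finset (Fin n), (Tᶜ).card = k ∧
    (√m * R < sMax (rowSubmatrix (A ω) T) ∨ sMin (rowSubmatrix (A ω) T) < √m * c)}

theorem badEvent_mono (A : Ω → Matrix (Fin n) (Fin m) ℝ) (k : ℕ) (R : ℝ) :
    Monotone (badEvent A k R) := by
  rintro c d hcd ω ⟨T, hT, h⟩
  exact ⟨T, hT, h.imp_right fun h => h.trans_le
    (mul_le_mul_of_nonneg_left hcd (Real.sqrt_nonneg _))⟩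

/-- The bad event for the optimal constant is an increasing union of bad events. -/
theorem badEvent_eq_iUnion (hm : 0 < m) (k : ℕ) (R c : ℝ) :
    badEvent A k R c = ⋃ j : ℕ, badEvent A k R (c - 1 / (j + 1)) := by
  refine Set.Subset.antisymm ?_ (Set.iUnion_subset fun j => badEvent_mono A k R ?_)
  · rintro ω ⟨T, hT, h⟩
    rcases h with h | h
    · exact Set.mem_iUnion.2 ⟨0, T, hT, Or.inl h⟩
    · have hsm : 0 < √(m : ℝ) := by positivity
      have h' : sMin (rowSubmatrix (A ω) T) / √m < c := by
        rwa [div_lt_iff₀ hsm, mul_comm]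
      obtain ⟨j, hj⟩ := exists_nat_one_div_lt (sub_pos.2 h')
      refine Set.mem_iUnion.2 ⟨j, T, hT, Or.inr ?_⟩
      rw [mul_comm, ← div_lt_iff₀ hsm]
      linarith
  · have : (0 : ℝ) ≤ 1 / (j + 1) := by positivity
    linarith

end BadEvent

/-- The entries are only almost everywhere measurable, so the Borel set of such matrices pulls back
to a null measurable set. -/
theorem nullMeasurableSet_isNERF {Ω : Type*} [MeasurableSpace Ω] {Pr : Measure Ω} {m n : ℕ}
    {A : Ω → Matrix (Fin n) (Fin m) ℝ} (hm : 0 < m) (hmn : m < n)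
    (hlaw : ∀ (i : Fin n) (j : Fin m), HasLaw (fun ω => A ω i j) (gaussianReal 0 1) Pr)
    {β C : ℝ} (hβ : β ∈ Set.Ioo (0 : ℝ) 1) (hβn : ∃ k : ℕ, β * n = k) (hC : 0 < C) :
    NullMeasurableSet {ω | IsNERF (A ω) β C} Pr := by
  let X : Ω → Fin n → Fin m → ℝ := fun ω i j => A ω i j
  have hX : AEMeasurable X Pr :=
    aemeasurable_pi_lambda _ fun i => aemeasurable_pi_lambda _ fun j => (hlaw i j).aemeasurable
  have hs : MeasurableSet {B : Fin n → Fin m → ℝ | IsNERF (Matrix.of B) β C} := by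
    simp_rw [isNERF_iff hmn hβ hβn hC]
    refine MeasurableSet.inter (s₁ := {B | _}) (s₂ := {B | _}) ?_ ?_
    · simp only [Set.ofPred_forall]
      refine MeasurableSet.iInter fun S => MeasurableSet.iInter fun hS => ?_
      simp_rw [linearIndependent_rows_iff_det_ne_zero _ (S.equivFinOfCardEq hS).symm]
      refine IsOpen.measurableSet (isOpen_ne_fun (Continuous.matrix_det ?_) continuous_const)
      exact continuous_pi fun i => continuous_pi fun j =>
        (continuous_apply j).comp (continuous_apply _)
    · simp only [Set.ofPred_forall]
      refine MeasurableSet.iInter fun T => MeasurableSet.iInter fun _ => ?_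
      have hmeas : ∀ (i : T) (j : Fin m), Measurable fun B : Fin n → Fin m → ℝ =>
          rowSubmatrix (Matrix.of B) T i j := fun i j =>
        (measurable_pi_apply j).comp (measurable_pi_apply (i : Fin n))
      exact (measurableSet_lt measurable_const (measurable_sMin_comp hm hmeas)).inter
        (measurableSet_le (measurable_sMax_comp hm hmeas)
          ((measurable_sMin_comp hm hmeas).const_mul C))
  exact hX.nullMeasurableSet_preimage hs

/-! ### Union bound over the erased rows. -/

section RandomMatrix

variable {Ω : Type*} [MeasurableSpace Ω] {Pr : Measure Ω} [IsProbabilityMeasure Pr]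
  {m n : ℕ} {A : Ω → Matrix (Fin n) (Fin m) ℝ}

theorem hasLaw_gaussPi_of_injective
    (hlaw : ∀ (i : Fin n) (j : Fin m), HasLaw (fun ω => A ω i j) (gaussianReal 0 1) Pr)
    (hindep : iIndepFun (fun (p : Fin n × Fin m) (ω : Ω) => A ω p.1 p.2) Pr)
    {κ : Type*} [Fintype κ] {g : κ → Fin n × Fin m} (hg : g.Injective) :
    HasLaw (fun ω k => A ω (g k).1 (g k).2) (gaussPi κ) Pr where
  aemeasurable := aemeasurable_pi_lambda _ fun k => (hlaw _ _).aemeasurable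
  map_eq := by
    rw [(iIndepFun_iff_map_fun_eq_pi_map fun k => (hlaw (g k).1 (g k).2).aemeasurable).1
      (hindep.precomp hg)]
    simp_rw [(hlaw _ _).map_eq]

theorem ae_linearIndependent_rows
    (hlaw : ∀ (i : Fin n) (j : Fin m), HasLaw (fun ω => A ω i j) (gaussianReal 0 1) Pr)
    (hindep : iIndepFun (fun (p : Fin n × Fin m) (ω : Ω) => A ω p.1 p.2) Pr) :
    ∀ᵐ ω ∂Pr, ∀ S : Finset (Fin n), S.card = m → LinearIndependent ℝ (fun i : S => A ω i) := by
  rw [ae_all_iff]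
  intro S
  by_cases hS : S.card = m
  swap
  · exact Eventually.of_forall fun ω h => absurd h hS
  let e : Fin m ≃ S := (S.equivFinOfCardEq hS).symm
  have hinj : Function.Injective fun q : Fin m × Fin m => (((e q.1 : S) : Fin n), q.2) := by
    rintro ⟨a, b⟩ ⟨c, d⟩ h
    simp only [Prod.mk.injEq] at h
    rw [Prod.mk.injEq]
    exact ⟨e.injective (Subtype.ext h.1), h.2⟩
  have hl := hasLaw_gaussPi_of_injective hlaw hindep hinj
  have hae := ae_gaussPi_det_ne_zero m
  rw [← hl.map_eq] at hae
  filter_upwards [ae_of_ae_map hl.aemeasurable hae] with ω hω _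
  exact (linearIndependent_rows_iff_det_ne_zero (A ω) e).2 hω

theorem measureReal_badEvent_le (hm : 0 < m) {k : ℕ} (hk : m + k < n)
    (hlaw : ∀ (i : Fin n) (j : Fin m), HasLaw (fun ω => A ω i j) (gaussianReal 0 1) Pr)
    (hindep : iIndepFun (fun (p : Fin n × Fin m) (ω : Ω) => A ω p.1 p.2) Pr)
    {lam α ε : ℝ} (hα : 0 ≤ α) (hε : 0 < ε) (hlam : 1 - lam = m / ((n - k : ℕ) : ℝ)) :
    Pr.real (badEvent A k (rC α lam) (√(qC (muC α ε) lam) - ε * rC (muC α ε) lam)) ≤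
      n.choose k * (2 * Real.exp (-(α * m))) := by
  set c := √(qC (muC α ε) lam) - ε * rC (muC α ε) lam
  let E : Finset (Fin n) → Set Ω := fun T =>
    {ω | √m * rC α lam < sMax (rowSubmatrix (A ω) T) ∨ sMin (rowSubmatrix (A ω) T) < √m * c}
  let 𝒯 : Finset (Finset (Fin n)) := Finset.powersetCard (n - k) Finset.univ
  have hsub : badEvent A k (rC α lam) c ⊆ ⋃ T ∈ 𝒯, E T := by
    rintro ω ⟨T, hT, h⟩
    have hc : T.card = n - k := by
      have := Finset.card_add_card_compl T
      rw [Fintype.card_fin] at this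
      omega
    exact Set.mem_biUnion (Finset.mem_powersetCard.2 ⟨Finset.subset_univ T, hc⟩) h
  have hE : ∀ T ∈ 𝒯, Pr.real (E T) ≤ 2 * Real.exp (-(α * m)) := by
    intro T hT
    have hTc : T.card = n - k := (Finset.mem_powersetCard.1 hT).2
    have : Nonempty T := by
      rw [Finset.nonempty_coe_sort, ← Finset.card_pos]
      omega
    have hinj : Function.Injective fun q : T × Fin m => ((q.1 : Fin n), q.2) := by
      rintro ⟨a, b⟩ ⟨c, d⟩ h
      simp only [Prod.mk.injEq] at h
      rw [Prod.mk.injEq]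
      exact ⟨Subtype.ext h.1, h.2⟩
    have hl := hasLaw_gaussPi_of_injective hlaw hindep hinj
    have hb := measureReal_singularValues_le (ι := T) hm (lam := lam) hα hε
      (by rw [Fintype.card_coe, hTc]; exact hlam)
    refine le_trans ?_ hb
    rw [← hl.map_eq]
    refine ENNReal.toReal_mono (by rw [hl.map_eq]; exact measure_ne_top _ _) ?_
    -- This inequality holds for arbitrary sets, so measurability of the bad events is not required.
    exact Measure.le_map_apply hl.aemeasurable _
  calc _ ≤ Pr.real (⋃ T ∈ 𝒯, E T) := measureReal_mono hsub (measure_ne_top _ _)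
    _ ≤ ∑ T ∈ 𝒯, Pr.real (E T) := measureReal_biUnion_finset_le 𝒯 E
    _ ≤ 𝒯.card • (2 * Real.exp (-(α * m))) := Finset.sum_le_card_nsmul _ _ _ hE
    _ = _ := by
      rw [nsmul_eq_mul, Finset.card_powersetCard, Finset.card_univ, Fintype.card_fin,
        Nat.choose_symm (by omega)]

/-- The supremum defining P need not be attained. Every level P - 1/(j+1) lies below the value at
some ε, and continuity from below passes the bound, which is free of ε, to P itself. -/
theorem measureReal_badEvent_PC_le (hm : 0 < m) {k : ℕ} (hk : m + k < n)
    (hlaw : ∀ (i : Fin n) (j : Fin m), HasLaw (fun ω => A ω i j) (gaussianReal 0 1) Pr)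
    (hindep : iIndepFun (fun (p : Fin n × Fin m) (ω : Ω) => A ω p.1 p.2) Pr)
    {ν lam β : ℝ} (hα : 0 ≤ alphaC ν lam β)
    (hlam : 1 - lamErased lam β = m / ((n - k : ℕ) : ℝ)) :
    Pr.real (badEvent A k (RC ν lam β) (PC ν lam β)) ≤
      n.choose k * (2 * Real.exp (-(alphaC ν lam β * m))) := by
  set b := n.choose k * (2 * Real.exp (-(alphaC ν lam β * m)))
  have hb : 0 ≤ b := by positivity
  have hj : ∀ j : ℕ, Pr (badEvent A k (RC ν lam β) (PC ν lam β - 1 / (j + 1))) ≤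
      ENNReal.ofReal b := by
    intro j
    have : Nonempty (Set.Ioo (0 : ℝ) 1) := ⟨⟨1 / 2, by norm_num, by norm_num⟩⟩
    obtain ⟨ε, hε⟩ := exists_lt_of_lt_ciSup
      (show PC ν lam β - 1 / ((j : ℝ) + 1) < PC ν lam β from
        sub_lt_self _ Nat.one_div_pos_of_nat)
    refine (measure_mono (badEvent_mono A k _ hε.le)).trans ?_
    rw [← ENNReal.ofReal_toReal (measure_ne_top Pr _)]
    exact ENNReal.ofReal_le_ofReal
      (measureReal_badEvent_le hm hk hlaw hindep hα ε.2.1 hlam)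
  rw [badEvent_eq_iUnion hm, Measure.real, Monotone.measure_iUnion]
  · refine ENNReal.toReal_le_of_le_ofReal hb (iSup_le hj)
  · intro i j hij
    refine badEvent_mono A k _ (sub_le_sub_left ?_ _)
    exact Nat.one_div_le_one_div hij

end RandomMatrix

end GaussianNERF

/-! ### The main theorem. -/

theorem theorem4p7 {Ω : Type*} [MeasurableSpace Ω] (Pr : MeasureTheory.Measure Ω)
    [MeasureTheory.IsProbabilityMeasure Pr]
    (m n : ℕ) (hm : 0 < m) (hmn : m < n)
    (A : Ω → Matrix (Fin n) (Fin m) ℝ)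
    (hlaw : ∀ (i : Fin n) (j : Fin m),
      ProbabilityTheory.HasLaw (fun ω => A ω i j) (ProbabilityTheory.gaussianReal 0 1) Pr)
    (hindep : ProbabilityTheory.iIndepFun
      (fun (p : Fin n × Fin m) (ω : Ω) => A ω p.1 p.2) Pr)
    (lam : ℝ) (hlam : lam = 1 - (m : ℝ) / n)
    (β : ℝ) (hβ : β ∈ Set.Ioo (0 : ℝ) lam) (hβn : ∃ k : ℕ, β * n = k)
    (ν : ℝ) (hν : 0 < ν) :
    (MeasureTheory.NullMeasurableSet
        {ω | IsNERF (A ω) β (RC ν lam β / PC ν lam β)} Pr ∧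
      1 - 3 * Real.exp (-ν * m) ≤
        Pr.real {ω | IsNERF (A ω) β (RC ν lam β / PC ν lam β)}) ∧
    1 - (m : ℝ) / ((1 - β) * n) = lamErased lam β ∧
    0 < lamErased lam β ∧
    0 < alphaC ν lam β ∧
    (∀ ε ∈ Set.Ioo (0 : ℝ) 1,
      0 < muC (alphaC ν lam β) ε ∧
      0 < rC (muC (alphaC ν lam β) ε) (lamErased lam β) ∧
      0 < qC (muC (alphaC ν lam β) ε) (lamErased lam β)) ∧
    0 < RC ν lam β ∧
    0 < PC ν lam β := by
  have hm0 : (0 : ℝ) < m := by exact_mod_cast hm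
  have hn0 : (0 : ℝ) < n := by exact_mod_cast hm.trans hmn
  have hlam1 : lam < 1 := by rw [hlam]; have : (0 : ℝ) < m / n := by positivity
                             linarith
  obtain ⟨hβ0, hβlam⟩ := hβ
  have hβ1 : β < 1 := hβlam.trans hlam1
  have hlE := one_sub_lamErased hβ1 hlam
  have hβ1' : 0 < 1 - β := by linarith
  have hE1 : lamErased lam β < 1 := by
    have : 0 < (m : ℝ) / ((1 - β) * n) := by positivity
    linarith
  have hE0 : 0 < lamErased lam β := div_pos (by linarith) hβ1'
  have hα := alphaC_pos hν hlam1 hβ0 hβ1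
  have hR : 0 < RC ν lam β := RC_pos hE1
  have hP : 0 < PC ν lam β := PC_pos hα.le hE1 hE0
  have hC : 0 < RC ν lam β / PC ν lam β := div_pos hR hP
  refine ⟨⟨nullMeasurableSet_isNERF hm hmn hlaw ⟨hβ0, hβ1⟩ hβn hC, ?_⟩, by linarith, hE0, hα,
    fun ε hε => ?_, hR, hP⟩
  swap
  · have hμ : 0 < muC (alphaC ν lam β) ε := hα.trans (lt_muC hε.1)
    exact ⟨hμ, rC_pos hE1, qC_pos hμ.le hE1⟩
  obtain ⟨k, hk⟩ := hβn
  have hkn : m + k < n := by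
    have h1 : lam * n = n - m := by rw [hlam]; field_simp
    have h2 : β * n < lam * n := mul_lt_mul_of_pos_right hβlam hn0
    have : (m : ℝ) + k < n := by linarith
    exact_mod_cast this
  have hlE' : 1 - lamErased lam β = m / ((n - k : ℕ) : ℝ) := by
    rw [hlE, Nat.cast_sub (by omega), ← hk]; congr 1; ring
  set bad := badEvent A k (RC ν lam β) (PC ν lam β) with hbad
  -- The entropy part of α absorbs the binomial coefficient, leaving ν.
  have hbadP : Pr.real bad ≤ 2 * Real.exp (-ν * m) := by
    refine (measureReal_badEvent_PC_le hm hkn hlaw hindep hα.le hlE').trans ?_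
    calc (n.choose k : ℝ) * (2 * Real.exp (-(alphaC ν lam β * m)))
        ≤ Real.exp ((alphaC ν lam β - ν) * m) * (2 * Real.exp (-(alphaC ν lam β * m))) := by
          rw [alphaC_sub hm hlam]
          exact mul_le_mul_of_nonneg_right (choose_le_exp_entropy hβ0 hβ1 hk) (by positivity)
      _ = 2 * (Real.exp ((alphaC ν lam β - ν) * m) * Real.exp (-(alphaC ν lam β * m))) := by ring
      _ = 2 * Real.exp (-ν * m) := by rw [← Real.exp_add]; congr 2; ring
  set good : Set Ω := {ω | IsNERF (A ω) β (RC ν lam β / PC ν lam β)} with hgood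
  -- Off the bad event the ratio of the two bounds is R/P, as √m cancels; independence of any m rows
  -- holds almost surely and costs no probability.
  have hcover : ∀ᵐ ω ∂Pr, ω ∈ good ∪ bad := by
    filter_upwards [ae_linearIndependent_rows hlaw hindep] with ω hω
    by_cases hb : ω ∈ bad
    · exact Or.inr hb
    left
    rw [hgood, Set.mem_ofPred_eq, isNERF_iff hmn ⟨hβ0, hβ1⟩ ⟨k, hk⟩ hC]
    refine ⟨hω, fun T hT => ?_⟩
    have hTk : (Tᶜ).card = k := by rw [hk] at hT; exact_mod_cast hT
    have hT2 : ¬ (√m * RC ν lam β < sMax (rowSubmatrix (A ω) T) ∨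
        sMin (rowSubmatrix (A ω) T) < √m * PC ν lam β) := fun h => hb ⟨T, hTk, h⟩
    rw [not_or, not_lt, not_lt] at hT2
    have hsm : 0 < √(m : ℝ) := by positivity
    refine ⟨(mul_pos hsm hP).trans_le hT2.2, hT2.1.trans ?_⟩
    calc √m * RC ν lam β = RC ν lam β / PC ν lam β * (√m * PC ν lam β) := by field_simp
      _ ≤ _ := mul_le_mul_of_nonneg_left hT2.2 hC.le
  have h1 : (1 : ℝ) ≤ Pr.real good + Pr.real bad := by
    have : Pr.real (good ∪ bad) = 1 := by
      rw [MeasureTheory.Measure.real, MeasureTheory.measure_congr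
        (Filter.eventuallyEq_univ.2 hcover : (good ∪ bad : Set Ω) =ᵐ[Pr] Set.univ)]
      simp
    rw [← this]
    exact MeasureTheory.measureReal_union_le _ _
  -- The failure bound has factor 2; positivity of the exponential weakens it to the stated 3.
  have := Real.exp_pos (-ν * m)
  linarith
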